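/- Let $p_1,p_2,p_3$ be distinct odd primes and let $\Omega$ be a set with $|\Omega|=2p_1p_2p_3$. Permutations act on the right, and $H^{g}=g^{-1}Hg$. Let $R_r=\langle \rho_1,\rho_2,\rho_3,\tau_1\rangle\le \mathrm{Sym}(\Omega)$ be a regular dihedral group, where $C_r=\langle\rho_1,\rho_2,\rho_3\rangle$ is cyclic, $|\rho_i|=p_i$, $|\tau_1|=2$ and $\tau_1^{-1}\alpha\tau_1=\alpha^{-1}$ for all $\alpha\in C_r$. Let $\pi\in\mathrm{Sym}(\Omega)$ and let $R_r^\pi=\langle\sigma_1,\sigma_2,\sigma_3,\tau_2\rangle$ be the conjugate group, where likewise $C_r^\pi=\langle\sigma_1,\sigma_2,\sigma_3\rangle$ is cyclic, $|\sigma_i|=p_i$, $|\tau_2|=2$ and $\tau_2$ inverts every element of $C_r^\pi$. Put $G=\langle R_r,R_r^\pi\rangle$, and fix a point $x\in\Omega$. For $0\le i\le 3$ let $\mathcal B_i$ be the partition of $\Omega$ into the orbits of $\langle\rho_1,\dots,\rho_i\rangle$ (so its blocks have cardinality $p_1\cdots p_i$). Suppose that each $\mathcal B_i$ is $G$-invariant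 and is also the partition into the orbits of $\langle\sigma_1,\dots,\sigma_i\rangle$, and that for each $1\le i\le 3$: * $x\sigma_i$ and $x\rho_i$ lie in the same block of $\mathcal B_{i-1}$; * for every block $B$ of $\mathcal B_i$ there is an integer $1\le j_B\le p_i-1$ such that for every $y\in B$ the points $y\sigma_i$ and $y\rho_i^{j_B}$ lie in the same block of $\mathcal B_{i-1}$. Suppose that $G$ is block-regular on $\mathcal B_2$: every element of $G$ that fixes some block of $\mathcal B_2$ setwise fixes every block of $\mathcal B_2$ setwise. Then there is some $\beta$ in the 2-closure $$G^{(2)}=\{\beta\in\mathrm{Sym}(\Omega):\ \forall y,z\in\Omega\ \exists g\in G\text{ with }(y\beta,z\beta)=(yg,zg)\}$$ such that $(R_r^{\pi})^{\beta}=\beta^{-1}R_r^\pi\beta=R_r$. -/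

import Mathlib

open Equiv (Perm)

namespace DihedralCI

/-!
Permutations act on the left here (`g y`). With permutations acting on the right and
`H ^ β = β⁻¹ H β`, the group `H ^ β` consists of the permutations `y ↦ β (h (β⁻¹ y))` with `h ∈ H`,
which is `conj H β` below.
-/

/-- The conjugate `H ^ β`. -/
def conj {Ω : Type*} (H : Subgroup (Perm Ω)) (β : Perm Ω) : Subgroup (Perm Ω) :=
  H.map (MulAut.conj β).toMonoidHom

/-- The 2-closure of a permutation group `G`: all permutations that agree on every ordered pair
of points with some element of `G`. -/
def twoClosure {Ω : Type*} (G : Subgroup (Perm Ω)) : Subgroup (Perm Ω) where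
  carrier := {β | ∀ y z : Ω, ∃ g ∈ G, (β y, β z) = (g y, g z)}
  one_mem' := fun _ _ => ⟨1, G.one_mem, rfl⟩
  mul_mem' := by
    intro a b ha hb y z
    obtain ⟨g, hg, h1⟩ := hb y z
    obtain ⟨k, hk, h2⟩ := ha (b y) (b z)
    refine ⟨k * g, G.mul_mem hk hg, ?_⟩
    simp only [Prod.mk.injEq, Equiv.Perm.mul_apply] at h1 h2 ⊢
    rw [← h1.1, ← h1.2]
    exact h2
  inv_mem' := by
    intro a ha y z
    obtain ⟨g, hg, h1⟩ := ha (a⁻¹ y) (a⁻¹ z)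
    refine ⟨g⁻¹, G.inv_mem hg, ?_⟩
    rw [Prod.mk.injEq] at h1 ⊢
    rw [Equiv.Perm.eq_inv_iff_eq, Equiv.Perm.eq_inv_iff_eq, ← h1.1, ← h1.2]
    exact ⟨a.apply_symm_apply y, a.apply_symm_apply z⟩

/-- A permutation group is regular if for all points `y`, `z` exactly one of its elements
maps `y` to `z`. -/
def IsRegular {Ω : Type*} (H : Subgroup (Perm Ω)) : Prop :=
  ∀ y z : Ω, ∃! g : Perm Ω, g ∈ H ∧ g y = z

/-- A partition, given as a `Setoid`, is `G`-invariant if `G` maps blocks to blocks. -/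
def IsInvariant {Ω : Type*} (G : Subgroup (Perm Ω)) (P : Setoid Ω) : Prop :=
  ∀ g ∈ G, ∀ B ∈ P.classes, g '' B ∈ P.classes

/-- `G` is block-regular on a partition if every element of `G` that fixes some block setwise
fixes every block setwise. -/
def IsBlockRegular {Ω : Type*} (G : Subgroup (Perm Ω)) (P : Setoid Ω) : Prop :=
  ∀ g ∈ G, ∀ B ∈ P.classes, g '' B = B → ∀ B' ∈ P.classes, g '' B' = B'

/-- The group `⟨ρ 0, …, ρ (s - 1)⟩`. -/
def cyc {Ω : Type*} {s : ℕ} (ρ : Fin s → Perm Ω) : Subgroup (Perm Ω) :=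
  Subgroup.closure (Set.range ρ)

/-- The group `⟨ρ 0, …, ρ (s - 1), τ⟩`. -/
def dih {Ω : Type*} {s : ℕ} (ρ : Fin s → Perm Ω) (τ : Perm Ω) : Subgroup (Perm Ω) :=
  Subgroup.closure (Set.range ρ ∪ {τ})

/-- The partition of `Ω` into the orbits of the group generated by the first `i` of the
permutations `ρ 0, ρ 1, …`; for `i = 0` it is the partition into singletons. -/
def orbitPartition {Ω : Type*} {s : ℕ} (ρ : Fin s → Perm Ω) (i : ℕ) : Setoid Ω :=
  MulAction.orbitRel (Subgroup.closure (ρ '' {j : Fin s | (j : ℕ) < i})) Ω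

/-- `ρ` and `τ` are standard generators of a dihedral group that acts regularly on `Ω`, where
`ρ i` has order `p i`. -/
structure IsRegularDihedral {Ω : Type*} {s : ℕ} (p : Fin s → ℕ) (ρ : Fin s → Perm Ω)
    (τ : Perm Ω) : Prop where
  orderOf_rot : ∀ i, orderOf (ρ i) = p i
  cyclic : IsCyclic (cyc ρ)
  orderOf_refl : orderOf τ = 2
  inverts : ∀ α ∈ cyc ρ, τ⁻¹ * α * τ = α⁻¹
  regular : IsRegular (dih ρ τ)

/-- The standing notation and assumptions, with indices `0, …, s - 1` for the primes: `R = dih ρ τ₁`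
and its conjugate `R ^ π = dih σ τ₂` are regular dihedral groups on `Ω`, `G = ⟨R, R ^ π⟩`,
and `𝓑ᵢ = orbitPartition ρ i` for `0 ≤ i ≤ s`. As `R` is regular, `𝓑ᵢ` automatically has blocks
of cardinality `p 0 * ⋯ * p (i - 1)`. -/
structure Setup {Ω : Type*} {s : ℕ} (p : Fin s → ℕ) (ρ σ : Fin s → Perm Ω)
    (τ₁ τ₂ π : Perm Ω) (x : Ω) : Prop where
  prime : ∀ i, (p i).Prime
  odd : ∀ i, Odd (p i)
  distinct : Function.Injective p
  card : Nat.card Ω = 2 * ∏ i, p i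
  dihedral₁ : IsRegularDihedral p ρ τ₁
  dihedral₂ : IsRegularDihedral p σ τ₂
  conj_cyc : conj (cyc ρ) π = cyc σ
  conj_dih : conj (dih ρ τ₁) π = dih σ τ₂
  invariant : ∀ i ≤ s, IsInvariant (dih ρ τ₁ ⊔ conj (dih ρ τ₁) π) (orbitPartition ρ i)
  same_orbits : ∀ i ≤ s, orbitPartition ρ i = orbitPartition σ i
  base_point : ∀ i : Fin s, orbitPartition ρ i (σ i x) (ρ i x)
  block_power : ∀ i : Fin s, ∀ B ∈ (orbitPartition ρ ((i : ℕ) + 1)).classes,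
    ∃ j : ℕ, 1 ≤ j ∧ j < p i ∧ ∀ y ∈ B, orbitPartition ρ i (σ i y) ((ρ i ^ j) y)

end DihedralCI

/-! Both dihedral groups are regular, so sending the image of `x` under a word in `σ, τ₂` to its
image under the same word in `ρ, τ` defines a permutation `β` that conjugates the second group onto
the first. It lies in the 2-closure of `G` if, for every word, some element of `G` fixes `x` and
carries the first image to the second (`exists_twoClosure_conj_word`). The proof produces these
elements after conjugating the second group inside `G` and changing generators.

Consider partitions `A ≤ B` for which `ρ` permutes the `A`-classes of each `B`-class in a cycle of
prime length `ℓ`. The generators of `G` centralize or invert `ρ` or `σ`, and `σ` acts on each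
`B`-class as a power of `ρ`; hence `G` acts on these cycles by affine maps. The translations in `G`
form, modulo `A`, a vector space over the field with `ℓ` elements with one coordinate per `B`-class,
and `ρ` is the constant vector 1. Two points are coupled when their coordinates always agree. For
uncoupled points some translation fixes the `A`-class of one and moves that of the other at will, so
the words only have to agree on the coupling class of `x`. They do after `τ` is multiplied by powers
of `ρ 0` and `ρ 1`. If `r` and `s` from the two groups agree at `x`, then `r⁻¹ * s` fixes every
class of the second partition by block-regularity, and it fixes the `A`-class of every point coupled
to `x`. Agreement therefore spreads and is multiplicative, and it suffices to check rotations of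
prime order and one reflection (`Config.matching`).

Combining the two primes requires powers, with exponent prime to one of them, that are translations
for the other. This is arranged by an averaging argument (`Config.exists_conj_mult_pow`): the
squared multipliers of the second group form a coboundary, and conjugation by a power of a product
of elements `r⁻¹ * s` removes its `q`-part.

There remain two cases. If coupling on the first level never joins distinct `ρ 0`-orbits inside one
class of the second partition, it refines coupling on the second level, and points are moved in two
stages (`Config.exists_conj_of_coupled_le`). Otherwise the `ρ 1`-orbits are `G`-invariant
(`Config.invariant_of_coupled`), each class of the second partition is a grid, and its two
coordinates are treated independently (`Config.exists_conj_of_invariant`). -/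

namespace DihedralCI

/-! ### Normal forms in a dihedral group and a criterion for conjugacy in the 2-closure. -/

/-- The rotation `ρ 0 ^ a 0 * ρ 1 ^ a 1 * ρ 2 ^ a 2`. -/
def rot {Ω : Type*} (ρ : Fin 3 → Perm Ω) (a : Fin 3 → ℤ) : Perm Ω :=
  ρ 0 ^ a 0 * ρ 1 ^ a 1 * ρ 2 ^ a 2

/-- The element `ρ 0 ^ a 0 * ρ 1 ^ a 1 * ρ 2 ^ a 2 * τ ^ e` of the dihedral group. -/
def word {Ω : Type*} (ρ : Fin 3 → Perm Ω) (τ : Perm Ω) (a : Fin 3 → ℤ) (e : ℕ) : Perm Ω :=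
  rot ρ a * τ ^ e

/-- The relations between standard generators of a dihedral group. -/
structure Relations {Ω : Type*} (p : Fin 3 → ℕ) (ρ : Fin 3 → Perm Ω) (τ : Perm Ω) : Prop where
  comm : ∀ i j, Commute (ρ i) (ρ j)
  pow : ∀ i, ρ i ^ p i = 1
  sq : τ ^ 2 = 1
  refl_mul : ∀ i, τ * ρ i = (ρ i)⁻¹ * τ

/-- Standard generators of a regular dihedral group of order `2 * p 0 * p 1 * p 2`, described by
their relations and the normal form of the elements of the group. -/
structure Std {Ω : Type*} (p : Fin 3 → ℕ) (ρ : Fin 3 → Perm Ω) (τ : Perm Ω) : Prop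
    extends Relations p ρ τ where
  trans : ∀ y z, ∃ a e, z = word ρ τ a e y
  free : ∀ y a e, word ρ τ a e y = y → (∀ i, (p i : ℤ) ∣ a i) ∧ Even e

section Words

variable {Ω : Type*} {p : Fin 3 → ℕ} {ρ : Fin 3 → Perm Ω} {τ : Perm Ω}

theorem Relations.rot_add (h : Relations p ρ τ) (a b : Fin 3 → ℤ) :
    rot ρ (a + b) = rot ρ a * rot ρ b := by
  have c10 := ((h.comm 1 0).zpow_zpow (a 1) (b 0)).eq
  have c20 := ((h.comm 2 0).zpow_zpow (a 2) (b 0)).eq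
  have c21 := ((h.comm 2 1).zpow_zpow (a 2) (b 1)).eq
  simp only [rot, Pi.add_apply, zpow_add]
  calc _ = ρ 0 ^ a 0 * (ρ 0 ^ b 0 * ρ 1 ^ a 1) * (ρ 1 ^ b 1 * ρ 2 ^ a 2) * ρ 2 ^ b 2 := by group
    _ = ρ 0 ^ a 0 * ρ 1 ^ a 1 * (ρ 0 ^ b 0 * ρ 2 ^ a 2) * ρ 1 ^ b 1 * ρ 2 ^ b 2 := by
      rw [← c10, ← c21]; group
    _ = _ := by rw [← c20]; group

theorem rot_zero : rot ρ 0 = 1 := by simp [rot]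

theorem Relations.rot_neg (h : Relations p ρ τ) (a : Fin 3 → ℤ) : rot ρ (-a) = (rot ρ a)⁻¹ := by
  rw [eq_inv_iff_mul_eq_one, ← h.rot_add, neg_add_cancel, rot_zero]

theorem Relations.rot_zsmul (h : Relations p ρ τ) (a : Fin 3 → ℤ) (n : ℤ) :
    rot ρ (n • a) = rot ρ a ^ n := by
  induction n using Int.induction_on with
  | zero => simp [rot_zero]
  | succ n ih => rw [add_smul, one_smul, h.rot_add, ih, zpow_add_one]
  | pred n ih => rw [sub_smul, one_smul, sub_eq_add_neg, h.rot_add, h.rot_neg, ih, zpow_sub_one]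

theorem Relations.rot_comm (h : Relations p ρ τ) (a b : Fin 3 → ℤ) :
    rot ρ a * rot ρ b = rot ρ b * rot ρ a := by
  rw [← h.rot_add, ← h.rot_add, add_comm]

theorem rot_single (i : Fin 3) (n : ℤ) : rot ρ (Pi.single i n) = ρ i ^ n := by
  fin_cases i <;> simp [rot]

theorem Relations.refl_mul_zpow (h : Relations p ρ τ) (i : Fin 3) (n : ℤ) :
    τ * ρ i ^ n = ρ i ^ (-n) * τ := by
  have : SemiconjBy τ (ρ i) (ρ i)⁻¹ := h.refl_mul i
  have := this.zpow_right n
  rw [zpow_neg, ← inv_zpow]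
  exact this

theorem Relations.refl_mul_rot (h : Relations p ρ τ) (a : Fin 3 → ℤ) :
    τ * rot ρ a = rot ρ (-a) * τ := by
  simp only [rot, Pi.neg_apply]
  calc _ = (τ * ρ 0 ^ a 0) * ρ 1 ^ a 1 * ρ 2 ^ a 2 := by group
    _ = ρ 0 ^ (-a 0) * (τ * ρ 1 ^ a 1) * ρ 2 ^ a 2 := by rw [h.refl_mul_zpow]; group
    _ = ρ 0 ^ (-a 0) * ρ 1 ^ (-a 1) * (τ * ρ 2 ^ a 2) := by rw [h.refl_mul_zpow]; group
    _ = _ := by rw [h.refl_mul_zpow]; group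

theorem Relations.refl_pow_mul_rot (h : Relations p ρ τ) (e : ℕ) (a : Fin 3 → ℤ) :
    τ ^ e * rot ρ a = rot ρ ((-1 : ℤ) ^ e • a) * τ ^ e := by
  induction e generalizing a with
  | zero => simp
  | succ e ih =>
    rw [pow_succ, mul_assoc, h.refl_mul_rot, ← mul_assoc, ih, mul_assoc, pow_succ (-1 : ℤ)]
    simp

theorem Relations.word_mul (h : Relations p ρ τ) (a b : Fin 3 → ℤ) (e f : ℕ) :
    word ρ τ a e * word ρ τ b f = word ρ τ (a + (-1 : ℤ) ^ e • b) (e + f) := by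
  simp only [word]
  rw [mul_assoc, ← mul_assoc (τ ^ e), h.refl_pow_mul_rot, h.rot_add, pow_add]
  group

theorem Relations.refl_pow_inv (h : Relations p ρ τ) (e : ℕ) : (τ ^ e)⁻¹ = τ ^ e := by
  rw [inv_eq_iff_mul_eq_one, ← pow_add, ← two_mul, pow_mul, h.sq, one_pow]

theorem Relations.word_inv (h : Relations p ρ τ) (a : Fin 3 → ℤ) (e : ℕ) :
    (word ρ τ a e)⁻¹ = word ρ τ (-((-1 : ℤ) ^ e • a)) e := by
  simp only [word]
  rw [mul_inv_rev, h.refl_pow_inv, ← h.rot_neg, h.refl_pow_mul_rot, smul_neg]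

theorem Relations.word_inv_mul (h : Relations p ρ τ) (a b : Fin 3 → ℤ) (e f : ℕ) :
    (word ρ τ a e)⁻¹ * word ρ τ b f = word ρ τ ((-1 : ℤ) ^ e • (b - a)) (e + f) := by
  rw [h.word_inv, h.word_mul]
  congr 1
  rw [smul_sub]; abel

theorem Relations.word_eq_one (h : Relations p ρ τ) {a : Fin 3 → ℤ} {e : ℕ}
    (ha : ∀ i, (p i : ℤ) ∣ a i)
    (he : Even e) : word ρ τ a e = 1 := by
  have key : ∀ i, ρ i ^ a i = 1 := fun i => by
    obtain ⟨k, hk⟩ := ha i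
    rw [hk, zpow_mul, zpow_natCast, h.pow, one_zpow]
  obtain ⟨k, rfl⟩ := he
  rw [word, rot, key, key, key, ← two_mul, pow_mul, h.sq]
  simp

theorem Std.word_mem (G : Subgroup (Perm Ω)) (hρ : ∀ i, ρ i ∈ G) (hτ : τ ∈ G)
    (a : Fin 3 → ℤ) (e : ℕ) : word ρ τ a e ∈ G :=
  G.mul_mem (G.mul_mem (G.mul_mem (G.zpow_mem (hρ 0) _) (G.zpow_mem (hρ 1) _))
    (G.zpow_mem (hρ 2) _)) (G.pow_mem hτ e)

theorem Std.word_apply_eq_iff (h : Std p ρ τ) (y : Ω) (a b : Fin 3 → ℤ) (e f : ℕ) :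
    word ρ τ a e y = word ρ τ b f y ↔
      (∀ i, (p i : ℤ) ∣ ((-1 : ℤ) ^ e • (b - a)) i) ∧ Even (e + f) := by
  have key : word ρ τ a e y = word ρ τ b f y ↔
      word ρ τ ((-1 : ℤ) ^ e • (b - a)) (e + f) y = y := by
    rw [← h.word_inv_mul, Equiv.Perm.mul_apply, Equiv.Perm.inv_eq_iff_eq, eq_comm]
  rw [key]
  refine ⟨fun hy => h.free y _ _ hy, fun hy => ?_⟩
  rw [h.word_eq_one hy.1 hy.2]
  rfl

theorem perm_apply_inv (g : Perm Ω) (y : Ω) : g (g⁻¹ y) = y := g.apply_symm_apply y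

theorem perm_inv_apply (g : Perm Ω) (y : Ω) : g⁻¹ (g y) = y := g.symm_apply_apply y

theorem twoClosure_mono {G H : Subgroup (Perm Ω)} (h : G ≤ H) : twoClosure G ≤ twoClosure H := by
  intro β hβ y z
  obtain ⟨g, hg, e⟩ := hβ y z
  exact ⟨g, h hg, e⟩

theorem le_twoClosure (G : Subgroup (Perm Ω)) : G ≤ twoClosure G :=
  fun g hg _ _ => ⟨g, hg, rfl⟩

/-- If corresponding elements of two regular dihedral subgroups of `G` move `x` to points in the
same orbit of the stabilizer of `x`, then the two subgroups are conjugate in the 2-closure. -/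
theorem exists_twoClosure_conj_word {σ : Fin 3 → Perm Ω} {τ₂ : Perm Ω} (h₁ : Std p ρ τ)
    (h₂ : Std p σ τ₂) (G : Subgroup (Perm Ω)) (hρ : ∀ i, ρ i ∈ G) (hτ : τ ∈ G)
    (hσ : ∀ i, σ i ∈ G) (hτ₂ : τ₂ ∈ G) (x : Ω)
    (h : ∀ a e, ∃ g ∈ G, g x = x ∧ g (word σ τ₂ a e x) = word ρ τ a e x) :
    ∃ β ∈ twoClosure G, ∀ a e, β * word σ τ₂ a e * β⁻¹ = word ρ τ a e := by
  choose A E hAE using h₂.trans x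
  choose A' E' hAE' using h₁.trans x
  have hf : ∀ a e, word ρ τ (A (word σ τ₂ a e x)) (E (word σ τ₂ a e x)) x = word ρ τ a e x := by
    intro a e
    rw [h₁.word_apply_eq_iff, ← h₂.word_apply_eq_iff x, ← hAE]
  have hf' : ∀ a e, word σ τ₂ (A' (word ρ τ a e x)) (E' (word ρ τ a e x)) x = word σ τ₂ a e x := by
    intro a e
    rw [h₂.word_apply_eq_iff, ← h₁.word_apply_eq_iff x, ← hAE']
  -- Coordinates of a point are unique modulo the `p i` and 2 in both groups, so `β` does not depend
  -- on the choice of `A` and `E`.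
  let β : Perm Ω :=
    { toFun := fun y => word ρ τ (A y) (E y) x
      invFun := fun y => word σ τ₂ (A' y) (E' y) x
      left_inv := fun y => by
        change word σ τ₂ (A' (word ρ τ (A y) (E y) x)) (E' (word ρ τ (A y) (E y) x)) x = y
        rw [hf', ← hAE]
      right_inv := fun y => by
        change word ρ τ (A (word σ τ₂ (A' y) (E' y) x)) (E (word σ τ₂ (A' y) (E' y) x)) x = y
        rw [hf, ← hAE'] }
  have hβ : ∀ a e, β (word σ τ₂ a e x) = word ρ τ a e x := hf
  have hβm : ∀ a e y, β (word σ τ₂ a e y) = word ρ τ a e (β y) := by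
    intro a e y
    obtain ⟨b, f, rfl⟩ := h₂.trans x y
    rw [hβ, ← Equiv.Perm.mul_apply (word σ τ₂ a e), h₂.word_mul, hβ, ← h₁.word_mul]
    rfl
  refine ⟨β, fun y z => ?_, fun a e => ?_⟩
  · obtain ⟨a, e, hz⟩ := h₂.trans x ((word σ τ₂ (A y) (E y))⁻¹ z)
    rw [Equiv.Perm.inv_eq_iff_eq] at hz
    obtain ⟨g, hg, hgx, hgz⟩ := h a e
    -- The pair `(y, z)` is brought to base point `x` by the second group, corrected there by `g`,
    -- and carried to `(β y, β z)` by the first group.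
    refine ⟨word ρ τ (A y) (E y) * g * (word σ τ₂ (A y) (E y))⁻¹,
      G.mul_mem (G.mul_mem (Std.word_mem G hρ hτ _ _) hg)
        (G.inv_mem (Std.word_mem G hσ hτ₂ _ _)), ?_⟩
    rw [Prod.mk.injEq]
    simp only [Equiv.Perm.mul_apply]
    constructor
    · have : (word σ τ₂ (A y) (E y))⁻¹ y = x := by
        rw [Equiv.Perm.inv_eq_iff_eq]; exact hAE y
      rw [this, hgx]
      rfl
    · have : (word σ τ₂ (A y) (E y))⁻¹ z = word σ τ₂ a e x := by
        rw [Equiv.Perm.inv_eq_iff_eq]; exact hz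
      rw [this, hgz, hz, hβm, hβ]
  · rw [mul_inv_eq_iff_eq_mul]
    ext y
    exact hβm a e y

end Words

/-! ### Affine actions on levels, translations and coupling. -/

section Levels

variable {Ω : Type*}

/-- `g` normalizes `ρ` on every `B`-class, modulo `A`. -/
def Normalizes (A B : Setoid Ω) (ρ g : Perm Ω) : Prop :=
  ∀ y, ∃ m : ℤ, ∀ z, B z y → A (g (ρ z)) ((ρ ^ m) (g z))

/-- On every `B`-class `σ` acts as a power of `ρ` with exponent prime to `ℓ`, modulo `A`. -/
def ActsAsPower (A B : Setoid Ω) (ℓ : ℕ) (ρ σ : Perm Ω) : Prop :=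
  ∀ y, ∃ j : ℤ, ¬ (ℓ : ℤ) ∣ j ∧ ∀ z, B z y → A (σ z) ((ρ ^ j) z)

/-- `A ≤ B` are partitions invariant under `G`, and `ρ` permutes the `A`-classes in each `B`-class
in one cycle of length `ℓ`. -/
structure PreLevel (G : Subgroup (Perm Ω)) (A B : Setoid Ω) (ℓ : ℕ) (ρ : Perm Ω) : Prop where
  prime : ℓ.Prime
  mem : ρ ∈ G
  invA : ∀ g ∈ G, ∀ y z, A y z → A (g y) (g z)
  invB : ∀ g ∈ G, ∀ y z, B y z → B (g y) (g z)
  le : ∀ y z, A y z → B y z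
  step : ∀ y, B (ρ y) y
  orbit : ∀ y z, B y z → ∃ a : ℤ, A y ((ρ ^ a) z)
  free : ∀ (a : ℤ) y, A ((ρ ^ a) y) y ↔ (ℓ : ℤ) ∣ a

/-- A `PreLevel` where `G` acts on every `B`-class by affine maps modulo `A`. -/
structure Level (G : Subgroup (Perm Ω)) (A B : Setoid Ω) (ℓ : ℕ) (ρ : Perm Ω) : Prop
    extends PreLevel G A B ℓ ρ where
  norm : ∀ g ∈ G, Normalizes A B ρ g

variable {G : Subgroup (Perm Ω)} {A B : Setoid Ω} {ℓ : ℕ} {ρ : Perm Ω}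

namespace PreLevel

variable (h : PreLevel G A B ℓ ρ)
include h

theorem invA_zpow (a : ℤ) {y z : Ω} (hyz : A y z) : A ((ρ ^ a) y) ((ρ ^ a) z) :=
  h.invA _ (G.zpow_mem h.mem a) _ _ hyz

theorem step_zpow (a : ℤ) (y : Ω) : B ((ρ ^ a) y) y := by
  induction a using Int.induction_on with
  | zero => exact B.refl _
  | succ n ih =>
    rw [add_comm, zpow_add, zpow_one]
    exact B.trans (h.step _) ih
  | pred n ih =>
    rw [sub_eq_neg_add, zpow_add, zpow_neg_one, Equiv.Perm.mul_apply]
    refine B.trans (B.symm ?_) ih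
    have := h.step (ρ⁻¹ ((ρ ^ (-n : ℤ)) y))
    rwa [perm_apply_inv] at this

theorem zpow_congr {a b : ℤ} {y : Ω} : A ((ρ ^ a) y) ((ρ ^ b) y) ↔ (ℓ : ℤ) ∣ a - b := by
  rw [← h.free (a - b) y]
  constructor
  · intro k
    have := h.invA_zpow (-b) k
    rwa [← Equiv.Perm.mul_apply, ← Equiv.Perm.mul_apply, ← zpow_add, ← zpow_add, neg_add_cancel,
      zpow_zero, neg_add_eq_sub] at this
  · intro k
    have := h.invA_zpow b k
    rwa [← Equiv.Perm.mul_apply, ← zpow_add, add_sub_cancel] at this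

theorem normalizes_zpow {g : Perm Ω} {y : Ω} {m : ℤ}
    (hm : ∀ z, B z y → A (g (ρ z)) ((ρ ^ m) (g z))) (a : ℤ) :
    ∀ z, B z y → A (g ((ρ ^ a) z)) ((ρ ^ (m * a)) (g z)) := by
  induction a using Int.induction_on with
  | zero => intro z _; simp
  | succ n ih =>
    intro z hz
    rw [add_comm (n : ℤ), zpow_add, zpow_one, Equiv.Perm.mul_apply, mul_add, mul_one, zpow_add,
      Equiv.Perm.mul_apply]
    exact A.trans (hm _ (B.trans (h.step_zpow _ _) hz)) (h.invA_zpow _ (ih z hz))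
  | pred n ih =>
    intro z hz
    have h1 := hm ((ρ ^ (-n - 1 : ℤ)) z) (B.trans (h.step_zpow _ _) hz)
    rw [← Equiv.Perm.mul_apply ρ, mul_self_zpow, sub_add_cancel] at h1
    have h2 := h.invA_zpow (-m) (A.trans (A.symm h1) (ih z hz))
    rw [← Equiv.Perm.mul_apply (ρ ^ _) (ρ ^ _), ← Equiv.Perm.mul_apply (ρ ^ _) (ρ ^ _), ← zpow_add,
      ← zpow_add, neg_add_cancel, zpow_zero] at h2
    rwa [show m * (-n - 1 : ℤ) = -m + m * -n by ring]

theorem not_dvd_of_normalizes {g : Perm Ω} (hg : g ∈ G) {y : Ω} {m : ℤ}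
    (hm : A (g (ρ y)) ((ρ ^ m) (g y))) : ¬ (ℓ : ℤ) ∣ m := by
  intro hd
  have h1 : A (g (ρ y)) (g y) := A.trans hm ((h.free _ _).2 hd)
  have h2 := h.invA _ (G.inv_mem hg) _ _ h1
  rw [perm_inv_apply, perm_inv_apply] at h2
  have h3 := (h.free 1 y).1 (by rwa [zpow_one])
  exact h.prime.one_lt.ne' (by exact_mod_cast Int.natAbs_dvd_natAbs.2 h3 |> Nat.dvd_one.1)

theorem exists_inv_mod {m : ℤ} (hm : ¬ (ℓ : ℤ) ∣ m) : ∃ m' : ℤ, (ℓ : ℤ) ∣ m * m' - 1 := by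
  have hc : IsCoprime (ℓ : ℤ) m :=
    (Prime.coprime_iff_not_dvd (Nat.prime_iff_prime_int.1 h.prime)).2 hm
  obtain ⟨u, v, huv⟩ := hc
  exact ⟨v, -u, by linarith⟩

theorem normalizes_mul {g k : Perm Ω} (hg : g ∈ G) (hk : k ∈ G) (hgn : Normalizes A B ρ g)
    (hkn : Normalizes A B ρ k) : Normalizes A B ρ (g * k) := by
  intro y
  obtain ⟨m, hm⟩ := hkn y
  obtain ⟨n, hn⟩ := hgn (k y)
  refine ⟨n * m, fun z hz => ?_⟩
  exact A.trans (h.invA _ hg _ _ (hm z hz))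
    (h.normalizes_zpow hn m _ (h.invB _ hk _ _ hz))

theorem normalizes_inv {g : Perm Ω} (hg : g ∈ G) (hgn : Normalizes A B ρ g) :
    Normalizes A B ρ g⁻¹ := by
  intro y
  obtain ⟨m, hm⟩ := hgn (g⁻¹ y)
  obtain ⟨m', hm'⟩ := h.exists_inv_mod (h.not_dvd_of_normalizes hg (hm _ (B.refl _)))
  refine ⟨m', fun z hz => ?_⟩
  have h1 := h.normalizes_zpow hm m' (g⁻¹ z) (h.invB _ (G.inv_mem hg) _ _ hz)
  rw [perm_apply_inv] at h1
  have h2 : A ((ρ ^ (m * m')) z) ((ρ ^ (1 : ℤ)) z) := h.zpow_congr.2 hm'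
  rw [zpow_one] at h2
  have h3 := h.invA _ (G.inv_mem hg) _ _ (A.symm (A.trans h1 h2))
  rwa [perm_inv_apply] at h3

theorem normalizes_closure {s : Set (Perm Ω)} (hG : G = Subgroup.closure s)
    (hs : ∀ g ∈ s, Normalizes A B ρ g) : Level G A B ℓ ρ := by
  refine { h with norm := fun g hg => ?_ }
  rw [hG] at hg
  induction hg using Subgroup.closure_induction with
  | mem g hg => exact hs g hg
  | one => exact fun y => ⟨1, fun z _ => A.refl _⟩
  | mul g k hg hk h1 h2 => rw [← hG] at hg hk; exact h.normalizes_mul hg hk h1 h2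
  | inv g hg h1 => rw [← hG] at hg; exact h.normalizes_inv hg h1

theorem actsAsPower_zpow {σ : Perm Ω} (hσ : σ ∈ G) {y : Ω} {j : ℤ}
    (hj : ∀ z, B z y → A (σ z) ((ρ ^ j) z)) (n : ℤ) :
    ∀ z, B z y → A ((σ ^ n) z) ((ρ ^ (j * n)) z) := by
  have hσB : ∀ z, B z y → B (σ z) y := fun z hz =>
    B.trans (h.le _ _ (hj z hz)) (B.trans (h.step_zpow _ _) hz)
  induction n using Int.induction_on with
  | zero => intro z _; simp
  | succ n ih =>
    intro z hz
    rw [zpow_add_one, Equiv.Perm.mul_apply, mul_add, mul_one, zpow_add, Equiv.Perm.mul_apply]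
    exact A.trans (ih _ (hσB z hz)) (h.invA_zpow _ (hj z hz))
  | pred n ih =>
    intro z hz
    have hz' : B ((ρ ^ (-j)) z) y := B.trans (h.step_zpow _ _) hz
    have h1 := h.invA _ (G.zpow_mem hσ (-n - 1 : ℤ)) _ _ (hj _ hz')
    rw [← Equiv.Perm.mul_apply (ρ ^ j), ← zpow_add, add_neg_cancel, zpow_zero,
      ← Equiv.Perm.mul_apply, ← zpow_add_one, sub_add_cancel] at h1
    refine A.trans (A.symm h1) (A.trans (ih _ hz') ?_)
    rw [← Equiv.Perm.mul_apply, ← zpow_add, show j * -(n : ℤ) + -j = j * (-n - 1 : ℤ) by ring]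

/-- If `σ` acts on each `B`-class as a power of `ρ` modulo `A` and `s` centralizes or inverts `σ`,
then `s` normalizes `ρ`. -/
theorem normalizes_of_semiconj {σ : Perm Ω} (hσ : σ ∈ G)
    (hpow : ActsAsPower A B ℓ ρ σ) {s : Perm Ω} (hs : s ∈ G) {ε : ℤ}
    (hsσ : s * σ = σ ^ ε * s) : Normalizes A B ρ s := by
  intro y
  obtain ⟨j, hj0, hj'⟩ := hpow y
  obtain ⟨i, -, hi'⟩ := hpow (s y)
  have hj := h.actsAsPower_zpow hσ hj'
  have hi := h.actsAsPower_zpow hσ hi'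
  obtain ⟨k, hk⟩ := h.exists_inv_mod hj0
  refine ⟨i * (ε * k), fun z hz => ?_⟩
  have h1 : A (ρ z) ((σ ^ k) z) := by
    refine A.trans ?_ (A.symm (hj k z hz))
    have := (h.zpow_congr (a := j * k) (b := 1) (y := z)).2 hk
    rw [zpow_one] at this
    exact A.symm this
  refine A.trans (h.invA _ hs _ _ h1) ?_
  have h2 : s * σ ^ k = σ ^ (ε * k) * s := by
    have : SemiconjBy s σ (σ ^ ε) := hsσ
    rw [zpow_mul]
    exact this.zpow_right k
  rw [← Equiv.Perm.mul_apply, h2]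
  exact hi _ _ (h.invB _ hs _ _ hz)

end PreLevel

namespace Level

/-- The elements of `G` that fix every `B`-class and commute with `ρ` modulo `A`. -/
def translations (h : Level G A B ℓ ρ) : Subgroup (Perm Ω) where
  carrier := {k | k ∈ G ∧ ∀ y, B (k y) y ∧ A (k (ρ y)) (ρ (k y))}
  one_mem' := ⟨G.one_mem, fun _ => ⟨B.refl _, A.refl _⟩⟩
  mul_mem' := by
    intro a b ha hb
    refine ⟨G.mul_mem ha.1 hb.1, fun y => ⟨B.trans (ha.2 _).1 (hb.2 _).1, ?_⟩⟩
    exact A.trans (h.invA _ ha.1 _ _ (hb.2 y).2) (ha.2 _).2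
  inv_mem' := by
    intro a ha
    refine ⟨G.inv_mem ha.1, fun y => ⟨?_, ?_⟩⟩
    · have := (ha.2 (a⁻¹ y)).1
      rw [perm_apply_inv] at this
      exact B.symm this
    · have := h.invA _ (G.inv_mem ha.1) _ _ (ha.2 (a⁻¹ y)).2
      rw [perm_apply_inv, perm_inv_apply] at this
      exact A.symm this

/-- Two points are coupled if every translation fixing the `A`-class of one of them fixes the
`A`-class of the other one. -/
def Coupled (h : Level G A B ℓ ρ) (y z : Ω) : Prop := ∀ t ∈ h.translations, A (t y) y ↔ A (t z) z

variable (h : Level G A B ℓ ρ)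
include h

variable {h} in
theorem Coupled.refl (y : Ω) : h.Coupled y y := fun _ _ => Iff.rfl

variable {h} in
theorem Coupled.symm {y z : Ω} (hc : h.Coupled y z) : h.Coupled z y := fun t ht => (hc t ht).symm

variable {h} in
theorem Coupled.trans {y z w : Ω} (hc : h.Coupled y z) (hd : h.Coupled z w) : h.Coupled y w :=
  fun t ht => (hc t ht).trans (hd t ht)

theorem zpow_translation {t : Perm Ω} (ht : t ∈ h.translations) (a : ℤ) (y : Ω) :
    A (t ((ρ ^ a) y)) ((ρ ^ a) (t y)) := by
  have := h.normalizes_zpow (y := y) (m := 1) (fun z _ => by simpa using (ht.2 z).2) a y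
    (B.refl _)
  simpa using this

theorem mem_translations : ρ ∈ h.translations :=
  ⟨h.mem, fun y => ⟨h.step y, A.refl _⟩⟩

/-- On a `B`-class `g⁻¹` turns `ρ` into a power of `ρ`, with which `t` commutes modulo `A`, and `g`
turns this power back into `ρ`. Normality of the translations makes coupling `G`-invariant. -/
theorem conj_mem_translations {t : Perm Ω} (ht : t ∈ h.translations) {g : Perm Ω} (hg : g ∈ G) :
    g * t * g⁻¹ ∈ h.translations := by
  refine ⟨G.mul_mem (G.mul_mem hg ht.1) (G.inv_mem hg), fun y => ?_⟩
  have hB : B ((g * t * g⁻¹) y) y := by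
    have := h.invB _ hg _ _ (ht.2 (g⁻¹ y)).1
    rwa [perm_apply_inv] at this
  refine ⟨hB, ?_⟩
  obtain ⟨m, hm⟩ := h.norm _ (G.inv_mem hg) y
  have h1 := h.invA _ (G.mul_mem hg ht.1) _ _ (hm y (B.refl _))
  have h2 := h.invA _ hg _ _ (h.zpow_translation ht m (g⁻¹ y))
  have h3 := h.invA _ hg _ _ (hm _ hB)
  simp only [Equiv.Perm.mul_apply, perm_apply_inv, perm_inv_apply]
    at h1 h2 h3 ⊢
  exact A.trans h1 (A.trans h2 (A.symm h3))

theorem coupled_apply {y z : Ω} (hc : h.Coupled y z) {g : Perm Ω} (hg : g ∈ G) :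
    h.Coupled (g y) (g z) := by
  intro t ht
  have key : ∀ u, A (t (g u)) (g u) ↔ A ((g⁻¹ * t * g) u) u := by
    intro u
    constructor
    · intro k
      have := h.invA _ (G.inv_mem hg) _ _ k
      rwa [perm_inv_apply] at this
    · intro k
      have := h.invA _ hg _ _ k
      simpa only [Equiv.Perm.mul_apply, perm_apply_inv] using this
  have hk := h.conj_mem_translations ht (G.inv_mem hg)
  rw [inv_inv] at hk
  rw [key, key, hc _ hk]

theorem coupled_of_rel {y z : Ω} (hyz : B y z) : h.Coupled y z := by
  intro t ht
  have key : ∀ u v, B u v → A (t v) v → A (t u) u := by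
    intro u v huv hv
    obtain ⟨a, ha⟩ := h.orbit _ _ huv
    exact A.trans (h.invA _ ht.1 _ _ ha) (A.trans (h.zpow_translation ht a v)
      (A.trans (h.invA_zpow a hv) (A.symm ha)))
  exact ⟨key z y (B.symm hyz), key y z hyz⟩

/-- A translation acts as the same power of `ρ` on coupled points. -/
theorem translation_eq_zpow {t : Perm Ω} (ht : t ∈ h.translations) {y z : Ω}
    (hc : h.Coupled y z) {j : ℤ} (hy : A (t y) ((ρ ^ j) y)) : A (t z) ((ρ ^ j) z) := by
  have hmem : ρ ^ (-j) * t ∈ h.translations :=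
    h.translations.mul_mem (h.translations.zpow_mem h.mem_translations _) ht
  have key : ∀ u, A ((ρ ^ (-j) * t) u) u ↔ A (t u) ((ρ ^ j) u) := by
    intro u
    constructor
    · intro k
      have := h.invA_zpow j k
      rwa [← Equiv.Perm.mul_apply, ← mul_assoc, ← zpow_add, add_neg_cancel, zpow_zero,
        one_mul] at this
    · intro k
      have := h.invA_zpow (-j) k
      rwa [← Equiv.Perm.mul_apply, ← Equiv.Perm.mul_apply, ← zpow_add, neg_add_cancel,
        zpow_zero] at this
  exact (key z).1 ((hc _ hmem).1 ((key y).2 hy))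

theorem pow_of_translation {t : Perm Ω} {y : Ω} {j : ℤ} (ht : t ∈ G) (hty : A (t y) ((ρ ^ j) y))
    (hcomm : ∀ a : ℤ, A (t ((ρ ^ a) y)) ((ρ ^ a) (t y))) (n : ℕ) :
    A ((t ^ n) y) ((ρ ^ (j * n)) y) := by
  induction n with
  | zero => simp
  | succ n ih =>
    rw [pow_succ', Equiv.Perm.mul_apply]
    refine A.trans (h.invA _ ht _ _ ih) (A.trans (hcomm _) ?_)
    have := h.invA_zpow (j * n) hty
    rwa [← Equiv.Perm.mul_apply (ρ ^ _) (ρ ^ _), ← zpow_add,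
      show j * (n : ℤ) + j = j * ((n + 1 : ℕ) : ℤ) by
      push_cast; ring] at this

theorem translation_pow {t : Perm Ω} (ht : t ∈ h.translations) {y : Ω} {j : ℤ}
    (hty : A (t y) ((ρ ^ j) y)) (n : ℕ) : A ((t ^ n) y) ((ρ ^ (j * n)) y) :=
  h.pow_of_translation ht.1 hty (fun a => h.zpow_translation ht a y) n

theorem translation_pow_prime {t : Perm Ω} (ht : t ∈ h.translations) (y : Ω) :
    A ((t ^ ℓ) y) y := by
  obtain ⟨a, ha⟩ := h.orbit _ _ (ht.2 y).1
  exact A.trans (h.translation_pow ht ha ℓ) ((h.free _ _).2 (dvd_mul_left _ _))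

/-- An uncoupled class can be moved while fixing the class of `y`. -/
theorem exists_translation_of_not_coupled {y z : Ω} (hc : ¬ h.Coupled y z) {z' : Ω}
    (hz : B z' z) : ∃ t ∈ h.translations, A (t y) y ∧ A (t z) z' := by
  obtain ⟨t, ht, h1, h2⟩ : ∃ t ∈ h.translations, A (t y) y ∧ ¬ A (t z) z := by
    rw [Coupled] at hc
    push Not at hc
    obtain ⟨t, ht, ⟨h1, h2⟩ | ⟨h1, h2⟩⟩ := hc
    · exact ⟨t, ht, h1, h2⟩
    -- Here `t` moves the class of `y` and fixes that of `z`; multiplying by `ρ ^ (-a)` exchanges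
    -- the roles.
    · obtain ⟨a, ha⟩ := h.orbit _ _ (ht.2 y).1
      have hm := h.translations.zpow_mem h.mem_translations (-a)
      have e1 := h.invA_zpow (-a) ha
      rw [← Equiv.Perm.mul_apply, ← Equiv.Perm.mul_apply, ← zpow_add, neg_add_cancel,
        zpow_zero] at e1
      refine ⟨_, h.translations.mul_mem hm ht, e1, fun k => h1 ?_⟩
      have e2 : A ((ρ ^ (-a)) z) z := A.trans (A.symm (h.invA_zpow (-a) h2)) k
      rw [h.free, dvd_neg, ← h.free a y] at e2
      exact A.trans ha e2
  obtain ⟨j, hj⟩ := h.orbit _ _ (ht.2 z).1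
  obtain ⟨b, hb⟩ := h.orbit _ _ hz
  have hnj : ¬ (ℓ : ℤ) ∣ j := fun hd => h2 (A.trans hj ((h.free _ _).2 hd))
  obtain ⟨i, hi⟩ := h.exists_inv_mod hnj
  have hℓ : (0 : ℤ) < ℓ := by exact_mod_cast h.prime.pos
  -- `t` shifts the class of `z` by `j`, so the shift `b` is reached by `t ^ n` with `n` congruent
  -- to `b / j`.
  set n : ℕ := ((i * b) % ℓ).toNat with hn
  have hn' : (n : ℤ) = (i * b) % ℓ := Int.toNat_of_nonneg (Int.emod_nonneg _ hℓ.ne')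
  refine ⟨t ^ n, h.translations.pow_mem ht n, ?_, ?_⟩
  · have := h.translation_pow ht (y := y) (j := 0) (by simpa using h1) n
    simpa using this
  · refine A.trans (h.translation_pow ht hj n) (A.trans (h.zpow_congr.2 ?_) (A.symm hb))
    rw [hn', show j * ((i * b) % ℓ) - b = (j * i - 1) * b - j * (i * b - (i * b) % ℓ) by ring]
    exact dvd_sub (hi.mul_right _) (Int.dvd_self_sub_emod.mul_left _)

/-- If `k` acts on the `B`-class of `z` as a power of `ρ`, and a power of `k` with exponent prime
to `ℓ` is a translation, then `k` fixes the `A`-class of `z` if it fixes the `A`-class of a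
coupled point. -/
theorem fixes_of_coupled_of_pow {k : Perm Ω} (hk : k ∈ G) {n : ℕ} (hn : ¬ ℓ ∣ n)
    (hkn : k ^ n ∈ h.translations) {y z : Ω} (hc : h.Coupled y z) (hy : A (k y) y)
    (hz : B (k z) z) (hkz : A (k (ρ z)) (ρ (k z))) : A (k z) z := by
  obtain ⟨a, ha⟩ := h.orbit _ _ hz
  have hcomm : ∀ b : ℤ, A (k ((ρ ^ b) z)) ((ρ ^ b) (k z)) := by
    obtain ⟨m, hm⟩ := h.norm k hk z
    intro b
    have h1 := A.trans (A.symm (hm z (B.refl _))) hkz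
    have h2 : (ℓ : ℤ) ∣ m - 1 := by
      rw [← h.zpow_congr (y := k z), zpow_one]; exact h1
    refine A.trans (h.normalizes_zpow hm b z (B.refl _)) (h.zpow_congr.2 ?_)
    rw [show m * b - b = (m - 1) * b by ring]
    exact h2.mul_right _
  have h1 := h.pow_of_translation hk ha hcomm n
  have h2 : A ((k ^ n) y) y := by
    clear hkn hn h1
    induction n with
    | zero => exact A.refl _
    | succ n ih =>
      rw [pow_succ', Equiv.Perm.mul_apply]
      exact A.trans (h.invA _ hk _ _ ih) hy
  have h3 : A ((ρ ^ (a * n)) z) z := A.trans (A.symm h1) ((hc _ hkn).1 h2)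
  rw [h.free] at h3
  refine A.trans ha ((h.free _ _).2 ((Int.Prime.dvd_mul' h.prime h3).resolve_right ?_))
  exact_mod_cast hn

/-- The multiplier of `k` on each class is prime to `ℓ`, so its power with exponent `ℓ - 1` is 1
modulo `ℓ` by Fermat. -/
theorem pow_sub_one_mem_translations {k : Perm Ω} (hk : k ∈ G) (hB : ∀ y, B (k y) y) :
    k ^ (ℓ - 1) ∈ h.translations := by
  refine ⟨G.pow_mem hk _, fun y => ⟨?_, ?_⟩⟩
  · generalize ℓ - 1 = n
    induction n with
    | zero => exact B.refl _
    | succ n ih =>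
      rw [pow_succ', Equiv.Perm.mul_apply]
      exact B.trans (hB _) ih
  · obtain ⟨m, hm⟩ := h.norm k hk y
    have key : ∀ n : ℕ, B ((k ^ n) y) y ∧ A ((k ^ n) (ρ y)) ((ρ ^ (m ^ n)) ((k ^ n) y)) := by
      intro n
      induction n with
      | zero => exact ⟨B.refl _, by simp⟩
      | succ n ih =>
        simp only [pow_succ' k, Equiv.Perm.mul_apply]
        refine ⟨B.trans (hB _) ih.1, A.trans (h.invA _ hk _ _ ih.2) ?_⟩
        rw [pow_succ']
        exact h.normalizes_zpow hm _ _ ih.1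
    refine A.trans (key _).2 ?_
    have h1 := h.not_dvd_of_normalizes hk (hm y (B.refl _))
    have := (h.zpow_congr (a := m ^ (ℓ - 1)) (b := 1) (y := (k ^ (ℓ - 1)) y)).2 ?_
    · rwa [zpow_one] at this
    · rw [← Int.modEq_iff_dvd]
      refine (Int.ModEq.pow_card_sub_one_eq_one h.prime ?_).symm
      exact ((Prime.coprime_iff_not_dvd (Nat.prime_iff_prime_int.1 h.prime)).2 h1).symm

theorem fixes_of_coupled {k : Perm Ω} (hk : k ∈ G) (hB : ∀ u, B (k u) u) {y z : Ω}
    (hc : h.Coupled y z) (hy : A (k y) y) (hkz : A (k (ρ z)) (ρ (k z))) : A (k z) z := by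
  refine h.fixes_of_coupled_of_pow hk (n := ℓ - 1) (fun hd => ?_)
    (h.pow_sub_one_mem_translations hk hB) hc hy (hB z) hkz
  have := h.prime.two_le
  have := Nat.le_of_dvd (by omega) hd
  omega

end Level

end Levels

/-! ### The multiplier cocycle of the affine action. -/

section Multipliers

variable {Ω : Type*} {G : Subgroup (Perm Ω)} {A B : Setoid Ω} {ℓ : ℕ} {ρ : Perm Ω}

theorem Level.actsAsPower_conj (h : Level G A B ℓ ρ) {σ γ : Perm Ω} (hγ : γ ∈ G)
    (hσ : ActsAsPower A B ℓ ρ σ) : ActsAsPower A B ℓ ρ (γ * σ * γ⁻¹) := by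
  intro y
  obtain ⟨j, hj0, hj⟩ := hσ (γ⁻¹ y)
  obtain ⟨m, hm⟩ := h.norm γ hγ (γ⁻¹ y)
  refine ⟨m * j, fun hd => ?_, fun z hz => ?_⟩
  · rcases Int.Prime.dvd_mul' h.prime hd with hd | hd
    · exact h.not_dvd_of_normalizes hγ (hm _ (B.refl _)) hd
    · exact hj0 hd
  · have hz' := h.invB _ (G.inv_mem hγ) _ _ hz
    have h1 := h.invA _ hγ _ _ (hj _ hz')
    have h2 := h.normalizes_zpow hm j _ hz'
    rw [perm_apply_inv] at h2
    exact A.trans h1 h2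

theorem PreLevel.intCast_eq_iff (h : PreLevel G A B ℓ ρ) {a b : ℤ} (y : Ω) :
    (a : ZMod ℓ) = b ↔ A ((ρ ^ a) y) ((ρ ^ b) y) := by
  rw [h.zpow_congr, eq_comm, ZMod.intCast_eq_intCast_iff_dvd_sub]

open Classical in
/-- The multiplier of the affine map induced by `g` on the `B`-class of `y`. -/
noncomputable def Level.mult (h : Level G A B ℓ ρ) (g : Perm Ω) (y : Ω) : ZMod ℓ :=
  -- The value 1 outside `G` is only a default.
  if hg : g ∈ G then ((h.norm g hg y).choose : ℤ) else 1

namespace Level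

variable (h : Level G A B ℓ ρ)
include h

theorem exists_mult {g : Perm Ω} (hg : g ∈ G) (y : Ω) :
    ∃ m : ℤ, h.mult g y = m ∧ ∀ z, B z y → A (g (ρ z)) ((ρ ^ m) (g z)) := by
  refine ⟨(h.norm g hg y).choose, ?_, (h.norm g hg y).choose_spec⟩
  rw [mult, dif_pos hg]

theorem mult_eq {g : Perm Ω} (hg : g ∈ G) {y z : Ω} (hz : B z y) {m : ℤ}
    (hm : A (g (ρ z)) ((ρ ^ m) (g z))) : h.mult g y = m := by
  obtain ⟨n, hn, hn'⟩ := h.exists_mult hg y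
  rw [hn, h.intCast_eq_iff (g z)]
  exact A.trans (A.symm (hn' z hz)) hm

theorem mult_ne_zero {g : Perm Ω} (hg : g ∈ G) (y : Ω) : h.mult g y ≠ 0 := by
  obtain ⟨n, hn, hn'⟩ := h.exists_mult hg y
  rw [hn, Ne, ZMod.intCast_zmod_eq_zero_iff_dvd]
  exact h.not_dvd_of_normalizes hg (hn' y (B.refl _))

theorem mult_congr {g : Perm Ω} (hg : g ∈ G) {y z : Ω} (hz : B z y) :
    h.mult g z = h.mult g y := by
  obtain ⟨n, hn, hn'⟩ := h.exists_mult hg z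
  rw [hn, h.mult_eq hg hz (hn' z (B.refl _))]

/-- This is the cocycle identity. For elements fixing every `B`-class it becomes multiplicativity on
each class, as `mult_list_prod` uses. -/
theorem mult_mul {g k : Perm Ω} (hg : g ∈ G) (hk : k ∈ G) (y : Ω) :
    h.mult (g * k) y = h.mult g (k y) * h.mult k y := by
  obtain ⟨m, hm, hm'⟩ := h.exists_mult hk y
  obtain ⟨n, hn, hn'⟩ := h.exists_mult hg (k y)
  rw [hm, hn, ← Int.cast_mul]
  refine h.mult_eq (G.mul_mem hg hk) (B.refl _) ?_
  exact A.trans (h.invA _ hg _ _ (hm' y (B.refl _))) (h.normalizes_zpow hn' m _ (B.refl _))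

theorem mult_one (y : Ω) : h.mult 1 y = 1 := by
  have := h.mult_eq G.one_mem (B.refl y) (m := 1) (by rw [zpow_one]; exact A.refl _)
  simpa using this

theorem mult_inv {g : Perm Ω} (hg : g ∈ G) (y : Ω) :
    h.mult g⁻¹ y * h.mult g (g⁻¹ y) = 1 := by
  rw [mul_comm, ← h.mult_mul hg (G.inv_mem hg), mul_inv_cancel, h.mult_one]

theorem mult_list_prod (l : List (Perm Ω)) (hl : ∀ k ∈ l, k ∈ G ∧ ∀ y, B (k y) y) (y : Ω) :
    l.prod ∈ G ∧ (∀ y, B (l.prod y) y) ∧ h.mult l.prod y = (l.map (h.mult · y)).prod := by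
  induction l with
  | nil => exact ⟨G.one_mem, fun y => B.refl _, h.mult_one y⟩
  | cons k l ih =>
    obtain ⟨h1, h2, h3⟩ := ih fun k hk => hl k (List.mem_cons_of_mem _ hk)
    obtain ⟨hk, hkB⟩ := hl k List.mem_cons_self
    refine ⟨?_, fun y => ?_, ?_⟩
    · rw [List.prod_cons]; exact G.mul_mem hk h1
    · rw [List.prod_cons]; exact B.trans (hkB _) (h2 _)
    · rw [List.prod_cons, List.map_cons, List.prod_cons, h.mult_mul hk h1, h3,
        h.mult_congr hk (h2 y)]

theorem mult_pow {k : Perm Ω} (hk : k ∈ G) (hkB : ∀ y, B (k y) y) (n : ℕ) (y : Ω) :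
    h.mult (k ^ n) y = h.mult k y ^ n := by
  have := (h.mult_list_prod (List.replicate n k)
    (fun k' hk' => by rw [List.eq_of_mem_replicate hk']; exact ⟨hk, hkB⟩) y).2.2
  simpa using this

theorem pow_mem_translations_of_mult {k : Perm Ω} (hk : k ∈ G) (hkB : ∀ y, B (k y) y) {n : ℕ}
    (hn : ∀ y, h.mult k y ^ n = 1) : k ^ n ∈ h.translations := by
  refine ⟨G.pow_mem hk n, fun y => ⟨?_, ?_⟩⟩
  · have := (h.mult_list_prod (List.replicate n k)
      (fun k' hk' => by rw [List.eq_of_mem_replicate hk']; exact ⟨hk, hkB⟩) y).2.1 y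
    simpa using this
  · obtain ⟨m, hm, hm'⟩ := h.exists_mult (G.pow_mem hk n) y
    refine A.trans (hm' y (B.refl _)) ?_
    rw [h.mult_pow hk hkB, hn, ← Int.cast_one, h.intCast_eq_iff ((k ^ n) y)] at hm
    exact A.symm (by simpa using hm)

end Level

end Multipliers

/-! ### Orbit partitions and the two levels attached to a pair of dihedral groups. -/

section Configurations

variable {Ω : Type*}

/-- The partition into the orbits of the group generated by `s`. -/
def orbits (s : Set (Perm Ω)) : Setoid Ω := MulAction.orbitRel (Subgroup.closure s) Ω

theorem orbits_iff {s : Set (Perm Ω)} {y z : Ω} :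
    orbits s y z ↔ ∃ g ∈ Subgroup.closure s, y = g z := by
  change y ∈ MulAction.orbit _ _ ↔ _
  constructor
  · rintro ⟨g, rfl⟩; exact ⟨g, g.2, rfl⟩
  · rintro ⟨g, hg, rfl⟩; exact ⟨⟨g, hg⟩, rfl⟩

theorem orbits_singleton {g : Perm Ω} {y z : Ω} : orbits {g} y z ↔ ∃ a : ℤ, y = (g ^ a) z := by
  simp only [orbits_iff, Subgroup.mem_closure_singleton, exists_exists_eq_and]

theorem orbits_pair {g k : Perm Ω} (hgk : Commute g k) {y z : Ω} :
    orbits {g, k} y z ↔ ∃ a b : ℤ, y = (g ^ a * k ^ b) z := by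
  rw [orbits_iff]
  constructor
  · rintro ⟨u, hu, rfl⟩
    suffices ∃ a b : ℤ, u = g ^ a * k ^ b by
      obtain ⟨a, b, rfl⟩ := this
      exact ⟨a, b, rfl⟩
    induction hu using Subgroup.closure_induction with
    | mem u hu =>
      rcases hu with rfl | rfl
      · exact ⟨1, 0, by simp⟩
      · exact ⟨0, 1, by simp⟩
    | one => exact ⟨0, 0, by simp⟩
    | mul u v _ _ hu hv =>
      obtain ⟨a, b, rfl⟩ := hu
      obtain ⟨c, d, rfl⟩ := hv
      refine ⟨a + c, b + d, ?_⟩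
      rw [zpow_add, zpow_add, mul_assoc, ← mul_assoc (k ^ b), ← (hgk.zpow_zpow c b).eq]
      group
    | inv u _ hu =>
      obtain ⟨a, b, rfl⟩ := hu
      exact ⟨-a, -b, by rw [mul_inv_rev, zpow_neg, zpow_neg, ← zpow_neg, ← zpow_neg,
        (hgk.zpow_zpow (-a) (-b)).eq]⟩
  · rintro ⟨a, b, rfl⟩
    exact ⟨_, Subgroup.mul_mem _ (Subgroup.zpow_mem _ (Subgroup.subset_closure (by simp)) _)
      (Subgroup.zpow_mem _ (Subgroup.subset_closure (by simp)) _), rfl⟩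

/-- Two regular dihedral subgroups of a group `G` that respects the partitions into the orbits of
`ρ 0` and of `ρ 0, ρ 1`, acts by affine maps on their classes, and is block-regular on the second
one. -/
structure Config (p : Fin 3 → ℕ) (G : Subgroup (Perm Ω)) (ρ : Fin 3 → Perm Ω) (τ : Perm Ω)
    (σ : Fin 3 → Perm Ω) (τ₂ : Perm Ω) : Prop where
  prime : ∀ i, (p i).Prime
  odd : ∀ i, Odd (p i)
  inj : Function.Injective p
  std₁ : Std p ρ τ
  std₂ : Std p σ τ₂
  mem_rot₁ : ∀ i, ρ i ∈ G
  mem_refl₁ : τ ∈ G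
  mem_rot₂ : ∀ i, σ i ∈ G
  mem_refl₂ : τ₂ ∈ G
  inv₁ : ∀ g ∈ G, ∀ y z, orbits {ρ 0} y z → orbits {ρ 0} (g y) (g z)
  inv₂ : ∀ g ∈ G, ∀ y z, orbits {ρ 0, ρ 1} y z → orbits {ρ 0, ρ 1} (g y) (g z)
  reg : ∀ g ∈ G, ∀ y, orbits {ρ 0, ρ 1} (g y) y → ∀ z, orbits {ρ 0, ρ 1} (g z) z
  norm₁ : ∀ g ∈ G, Normalizes ⊥ (orbits {ρ 0}) (ρ 0) g
  norm₂ : ∀ g ∈ G, Normalizes (orbits {ρ 0}) (orbits {ρ 0, ρ 1}) (ρ 1) g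
  pow₁ : ActsAsPower ⊥ (orbits {ρ 0}) (p 0) (ρ 0) (σ 0)
  pow₂ : ActsAsPower (orbits {ρ 0}) (orbits {ρ 0, ρ 1}) (p 1) (ρ 1) (σ 1)
  agree_rot : ∀ y, orbits {ρ 0, ρ 1} (σ 2 y) (ρ 2 y)
  agree_refl : ∀ y, orbits {ρ 0, ρ 1} (τ₂ y) (τ y)

variable {p : Fin 3 → ℕ} {G : Subgroup (Perm Ω)} {ρ σ : Fin 3 → Perm Ω} {τ τ₂ : Perm Ω}

namespace Std

variable (h : Std p ρ τ)
include h

theorem orbits_rot {y z : Ω} :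
    orbits {ρ 0, ρ 1} y z ↔ ∃ a b : ℤ, y = word ρ τ ![a, b, 0] 0 z := by
  rw [orbits_pair (h.comm 0 1)]
  simp [word, rot]

theorem orbits_word_iff (y : Ω) (a b : Fin 3 → ℤ) (e f : ℕ) :
    orbits {ρ 0, ρ 1} (word ρ τ a e y) (word ρ τ b f y) ↔
      (p 2 : ℤ) ∣ b 2 - a 2 ∧ Even (e + f) := by
  have hs : ∀ (n : ℤ), (p 2 : ℤ) ∣ (-1) ^ e * n ↔ (p 2 : ℤ) ∣ n := fun n =>
    IsUnit.dvd_mul_left (IsUnit.pow _ isUnit_one.neg)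
  rw [h.orbits_rot]
  constructor
  · rintro ⟨c, d, hcd⟩
    rw [← Equiv.Perm.mul_apply, h.word_mul, h.word_apply_eq_iff] at hcd
    have h2 := hcd.1 2
    simp [hs] at h2
    exact ⟨h2, by simpa using hcd.2⟩
  · rintro ⟨h1, h2⟩
    refine ⟨a 0 - b 0, a 1 - b 1, ?_⟩
    rw [← Equiv.Perm.mul_apply, h.word_mul, h.word_apply_eq_iff]
    refine ⟨fun i => ?_, by simpa using h2⟩
    fin_cases i
    · simp [Matrix.vecHead]
    · simp [Matrix.vecHead, Matrix.vecTail]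
    · simpa [hs, Matrix.vecHead, Matrix.vecTail] using h1

theorem word_mul_gen (a : Fin 3 → ℤ) (e : ℕ) (i : Fin 3) :
    word ρ τ a e * ρ i = ρ i ^ ((-1 : ℤ) ^ e) * word ρ τ a e := by
  have h1 : ∀ n : ℤ, ρ i ^ n = word ρ τ (Pi.single i n) 0 := fun n => by
    rw [word, rot_single, pow_zero, mul_one]
  rw [h1, ← zpow_one (ρ i), h1, h.word_mul, h.word_mul]
  have h2 : (-1 : ℤ) ^ e • (Pi.single i 1 : Fin 3 → ℤ) = Pi.single i ((-1) ^ e) := by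
    rw [← Pi.single_smul]; simp
  rw [h2, add_comm]
  simp

theorem conj (γ : Perm Ω) : Std p (fun i => γ * ρ i * γ⁻¹) (γ * τ * γ⁻¹) := by
  have hw : ∀ a e, word (fun i => γ * ρ i * γ⁻¹) (γ * τ * γ⁻¹) a e = γ * word ρ τ a e * γ⁻¹ := by
    intro a e
    simp only [word, rot, conj_zpow, conj_pow]
    group
  refine ⟨⟨fun i j => ?_, fun i => ?_, ?_, fun i => ?_⟩, fun y z => ?_, fun y a e hy => ?_⟩
  · have := (h.comm i j).eq
    rw [commute_iff_eq]
    calc _ = γ * (ρ i * ρ j) * γ⁻¹ := by group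
      _ = _ := by rw [this]; group
  · rw [conj_pow, h.pow]; group
  · rw [conj_pow, h.sq]; group
  · calc _ = γ * (τ * ρ i) * γ⁻¹ := by group
      _ = _ := by rw [h.refl_mul]; group
  · obtain ⟨a, e, hz⟩ := h.trans (γ⁻¹ y) (γ⁻¹ z)
    refine ⟨a, e, ?_⟩
    rw [hw, Equiv.Perm.mul_apply, Equiv.Perm.mul_apply, ← hz, perm_apply_inv]
  · rw [hw, Equiv.Perm.mul_apply, Equiv.Perm.mul_apply] at hy
    exact h.free (γ⁻¹ y) a e (by rw [Equiv.Perm.eq_inv_iff_eq]; exact hy)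

theorem preLevel₁ (hp : ∀ i, (p i).Prime) (hρ : ∀ i, ρ i ∈ G)
    (hB : ∀ g ∈ G, ∀ y z, orbits {ρ 0} y z → orbits {ρ 0} (g y) (g z)) :
    PreLevel G ⊥ (orbits {ρ 0}) (p 0) (ρ 0) where
  prime := hp 0
  mem := hρ 0
  invA := by
    intro g _ y z hyz
    rw [Setoid.bot_def] at hyz ⊢
    rw [hyz]
  invB := hB
  le := by
    intro y z hyz
    rw [Setoid.bot_def] at hyz
    rw [hyz]
  step := fun y => orbits_singleton.2 ⟨1, by simp⟩
  orbit := fun y z hyz => by simpa [Setoid.bot_def] using orbits_singleton.1 hyz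
  free := by
    intro a y
    have h1 : (ρ 0 ^ a) y = word ρ τ (Pi.single 0 a) 0 y := by simp [word, rot]
    rw [Setoid.bot_def, h1]
    constructor
    · intro k; simpa using (h.free _ _ _ k).1 0
    · intro k
      rw [h.word_eq_one (fun i => by fin_cases i <;> simp [k]) (by simp)]
      rfl

/-- Both orders of the two primes occur: `i = 0, j = 1` is the given second level, while `i = 1, j =
0` appears once the `ρ 1`-orbits are known to be invariant. -/
theorem preLevel₂ (hp : ∀ i, (p i).Prime) (hρ : ∀ i, ρ i ∈ G)
    (hB : ∀ g ∈ G, ∀ y z, orbits {ρ 0, ρ 1} y z → orbits {ρ 0, ρ 1} (g y) (g z))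
    {i j : Fin 2} (hij : i ≠ j)
    (hA : ∀ g ∈ G, ∀ y z, orbits {ρ i.castSucc} y z → orbits {ρ i.castSucc} (g y) (g z)) :
    PreLevel G (orbits {ρ i.castSucc}) (orbits {ρ 0, ρ 1}) (p j.castSucc) (ρ j.castSucc) where
  prime := hp _
  mem := hρ _
  invA := hA
  invB := hB
  le := by
    intro y z hyz
    obtain ⟨a, rfl⟩ := orbits_singleton.1 hyz
    rw [orbits_pair (h.comm 0 1)]
    fin_cases i
    · exact ⟨a, 0, by simp⟩
    · exact ⟨0, a, by simp⟩
  step := by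
    intro y
    rw [orbits_pair (h.comm 0 1)]
    fin_cases j
    · exact ⟨1, 0, by simp⟩
    · exact ⟨0, 1, by simp⟩
  orbit := by
    intro y z hyz
    obtain ⟨a, b, rfl⟩ := (orbits_pair (h.comm 0 1)).1 hyz
    simp only [orbits_singleton]
    fin_cases i <;> fin_cases j
    · exact absurd rfl hij
    · exact ⟨b, a, rfl⟩
    · refine ⟨a, b, ?_⟩
      rw [((h.comm 0 1).zpow_zpow a b).eq]
      rfl
    · exact absurd rfl hij
  free := by
    intro a y
    rw [orbits_singleton]
    have h1 : ∀ (k : Fin 3) (n : ℤ) z, (ρ k ^ n) z = word ρ τ (Pi.single k n) 0 z := by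
      intro k n z
      rw [word, rot_single, pow_zero, mul_one]
    simp only [h1]
    constructor
    · rintro ⟨b, hb⟩
      have := ((h.word_apply_eq_iff y _ _ 0 0).1 hb).1 j.castSucc
      rw [pow_zero, one_smul, Pi.sub_apply, Pi.single_eq_same, Pi.single_eq_of_ne] at this
      · simpa using this
      · simpa using hij.symm
    · intro hd
      refine ⟨0, ?_⟩
      rw [h.word_apply_eq_iff]
      refine ⟨fun k => ?_, by simp⟩
      rw [pow_zero, one_smul, Pi.single_zero, zero_sub, Pi.neg_apply, dvd_neg]
      rcases eq_or_ne k j.castSucc with rfl | hk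
      · simpa using hd
      · rw [Pi.single_eq_of_ne hk]; exact dvd_zero _

end Std

namespace Config

variable (h : Config p G ρ τ σ τ₂)
include h

theorem level₁ : Level G ⊥ (orbits {ρ 0}) (p 0) (ρ 0) :=
  { h.std₁.preLevel₁ h.prime h.mem_rot₁ h.inv₁ with norm := h.norm₁ }

theorem preLevel₂ {i j : Fin 2} (hij : i ≠ j)
    (hA : ∀ g ∈ G, ∀ y z, orbits {ρ i.castSucc} y z → orbits {ρ i.castSucc} (g y) (g z)) :
    PreLevel G (orbits {ρ i.castSucc}) (orbits {ρ 0, ρ 1}) (p j.castSucc) (ρ j.castSucc) :=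
  h.std₁.preLevel₂ h.prime h.mem_rot₁ h.inv₂ hij hA

theorem level₂ : Level G (orbits {ρ 0}) (orbits {ρ 0, ρ 1}) (p 1) (ρ 1) :=
  { h.preLevel₂ (i := 0) (j := 1) (by decide) h.inv₁ with norm := h.norm₂ }

/-- Each generator of the second group agrees with its counterpart modulo the second partition,
where `σ 0, σ 1, ρ 0, ρ 1` are even trivial. Agreement passes to products and inverses because `G`
preserves the partition. -/
theorem agree_word (y : Ω) (a : Fin 3 → ℤ) (e : ℕ) :
    orbits {ρ 0, ρ 1} (word σ τ₂ a e y) (word ρ τ a e y) := by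
  set B := orbits {ρ 0, ρ 1} with hB
  have hL := h.level₂
  have hmul : ∀ g g' k k' : Perm Ω, g ∈ G → (∀ y, B (g y) (g' y)) → (∀ y, B (k y) (k' y)) →
      ∀ y, B ((g * k) y) ((g' * k') y) := fun g g' k k' hg h1 h2 y =>
    B.trans (h.inv₂ g hg _ _ (h2 y)) (h1 _)
  have hone : ∀ y, B ((1 : Perm Ω) y) ((1 : Perm Ω) y) := fun y => B.refl _
  have hinv : ∀ g g' : Perm Ω, g ∈ G → (∀ y, B (g y) (g' y)) → ∀ y, B (g⁻¹ y) (g'⁻¹ y) := by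
    intro g g' hg h1 y
    have := h.inv₂ _ (G.inv_mem hg) _ _ (h1 (g'⁻¹ y))
    rw [perm_inv_apply, perm_apply_inv] at this
    exact B.symm this
  have hpow : ∀ g g' : Perm Ω, g ∈ G → (∀ y, B (g y) (g' y)) → ∀ n : ℕ, ∀ y,
      B ((g ^ n) y) ((g' ^ n) y) := by
    intro g g' hg h1 n
    induction n with
    | zero => exact hone
    | succ n ih =>
      rw [pow_succ', pow_succ']
      exact hmul _ _ _ _ hg h1 ih
  have hzpow : ∀ g g' : Perm Ω, g ∈ G → (∀ y, B (g y) (g' y)) → ∀ n : ℤ, ∀ y,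
      B ((g ^ n) y) ((g' ^ n) y) := by
    intro g g' hg h1 n
    obtain ⟨n, rfl | rfl⟩ := n.eq_nat_or_neg
    · simpa using hpow g g' hg h1 n
    · simp only [zpow_neg, zpow_natCast]
      exact hinv _ _ (G.pow_mem hg n) (hpow g g' hg h1 n)
  have hρ0 : ∀ y, B (ρ 0 y) y := fun y =>
    (orbits_pair (h.std₁.comm 0 1)).2 ⟨1, 0, by simp⟩
  have h0 : ∀ y, B (σ 0 y) (ρ 0 y) := by
    intro y
    obtain ⟨j, -, hj⟩ := h.pow₁ y
    have := hj y ((orbits {ρ 0}).refl' _)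
    rw [Setoid.bot_def] at this
    rw [this, orbits_pair (h.std₁.comm 0 1)]
    refine ⟨j - 1, 0, ?_⟩
    rw [zpow_zero, mul_one, ← Equiv.Perm.mul_apply, ← zpow_add_one, sub_add_cancel]
  have h1 : ∀ y, B (σ 1 y) (ρ 1 y) := by
    intro y
    obtain ⟨j, -, hj⟩ := h.pow₂ y
    exact B.trans (hL.le _ _ (hj y (B.refl _)))
      (B.trans (hL.step_zpow _ _) (B.symm (hL.step _)))
  refine hmul _ _ _ _ (G.mul_mem (G.mul_mem (G.zpow_mem (h.mem_rot₂ 0) _)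
    (G.zpow_mem (h.mem_rot₂ 1) _)) (G.zpow_mem (h.mem_rot₂ 2) _)) ?_
    (hpow _ _ h.mem_refl₂ h.agree_refl e) y
  refine hmul _ _ _ _ (G.mul_mem (G.zpow_mem (h.mem_rot₂ 0) _)
    (G.zpow_mem (h.mem_rot₂ 1) _)) ?_ (hzpow _ _ (h.mem_rot₂ 2) h.agree_rot _)
  exact hmul _ _ _ _ (G.zpow_mem (h.mem_rot₂ 0) _) (hzpow _ _ (h.mem_rot₂ 0) h0 _)
    (hzpow _ _ (h.mem_rot₂ 1) h1 _)

/-- Conjugating the second dihedral group by an element that fixes all blocks, and shrinking the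
group that contains the two dihedral groups. -/
theorem conj {γ : Perm Ω} (hγ : γ ∈ G) (hγB : ∀ y, orbits {ρ 0, ρ 1} (γ y) y)
    {H : Subgroup (Perm Ω)} (hH : H ≤ G) (h1 : ∀ i, ρ i ∈ H) (h2 : τ ∈ H)
    (h3 : ∀ i, γ * σ i * γ⁻¹ ∈ H) (h4 : γ * τ₂ * γ⁻¹ ∈ H) :
    Config p H ρ τ (fun i => γ * σ i * γ⁻¹) (γ * τ₂ * γ⁻¹) := by
  have hγB' : ∀ y, orbits {ρ 0, ρ 1} (γ⁻¹ y) y := fun y => by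
    have := hγB (γ⁻¹ y)
    rw [perm_apply_inv] at this
    exact (orbits {ρ 0, ρ 1}).symm' this
  have key : ∀ s ∈ G, ∀ y, orbits {ρ 0, ρ 1} ((γ * s * γ⁻¹) y) (s y) := fun s hs y =>
    (orbits {ρ 0, ρ 1}).trans' (hγB _) (h.inv₂ _ hs _ _ (hγB' y))
  exact
    { prime := h.prime
      odd := h.odd
      inj := h.inj
      std₁ := h.std₁
      std₂ := h.std₂.conj γ
      mem_rot₁ := h1
      mem_refl₁ := h2
      mem_rot₂ := h3
      mem_refl₂ := h4
      inv₁ := fun g hg => h.inv₁ g (hH hg)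
      inv₂ := fun g hg => h.inv₂ g (hH hg)
      reg := fun g hg => h.reg g (hH hg)
      norm₁ := fun g hg => h.norm₁ g (hH hg)
      norm₂ := fun g hg => h.norm₂ g (hH hg)
      pow₁ := h.level₁.actsAsPower_conj hγ h.pow₁
      pow₂ := h.level₂.actsAsPower_conj hγ h.pow₂
      agree_rot := fun y => (orbits {ρ 0, ρ 1}).trans' (key _ (h.mem_rot₂ 2) y) (h.agree_rot y)
      agree_refl := fun y => (orbits {ρ 0, ρ 1}).trans' (key _ h.mem_refl₂ y) (h.agree_refl y) }

end Config

end Configurations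

/-! ### Removing the `q`-part of the multipliers by averaging over the classes. -/

theorem exists_mul_eq_one_add {N m : ℕ} (h : Nat.Coprime N m) (n : ℕ) (hm : 1 < m) :
    ∃ a t : ℕ, N * a = 1 + m ^ n * t := by
  obtain ⟨a, ha⟩ := Nat.exists_mul_mod_eq_one_of_coprime (k := m ^ (n + 1))
    (h.pow_right _) (Nat.one_lt_pow (by omega) hm)
  refine ⟨a, m * (N * a / m ^ (n + 1)), ?_⟩
  have := Nat.mod_add_div (N * a) (m ^ (n + 1))
  rw [ha.2] at this
  generalize N * a / m ^ (n + 1) = d at this ⊢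
  rw [← this]
  ring

namespace Config

variable {Ω : Type*} {p : Fin 3 → ℕ} {G : Subgroup (Perm Ω)} {ρ σ : Fin 3 → Perm Ω}
  {τ τ₂ : Perm Ω} (h : Config p G ρ τ σ τ₂)
include h

/-- The words representing the classes of `ρ 0, ρ 1` permute these classes regularly. -/
theorem bijective_class (y : Ω) :
    Function.Bijective (fun ce : Fin (p 2) × Fin 2 =>
      (Quotient.mk (orbits {ρ 0, ρ 1})
        (word ρ τ (Pi.single 2 ((ce.1 : ℕ) : ℤ)) (ce.2 : ℕ) y))) := by
  constructor
  · rintro ⟨c, e⟩ ⟨c', e'⟩ hce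
    have := Quotient.exact hce
    have := (h.std₁.orbits_word_iff _ _ _ _ _).1 this
    simp only [Pi.single_eq_same] at this
    obtain ⟨h1, h2⟩ := this
    have hc : (c : ℕ) = c' := by
      have := Nat.modEq_iff_dvd.2 h1
      rwa [Nat.ModEq, Nat.mod_eq_of_lt c.2, Nat.mod_eq_of_lt c'.2] at this
    have he : e = e' := by
      fin_cases e <;> fin_cases e' <;> simp_all
    rw [Prod.mk.injEq]
    exact ⟨Fin.ext hc, he⟩
  · intro q
    induction q using Quotient.inductionOn with
    | h z =>
      obtain ⟨a, e, rfl⟩ := h.std₁.trans y z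
      have hp : (0 : ℤ) < p 2 := by exact_mod_cast (h.prime 2).pos
      have hlt := Int.emod_lt_of_pos (a 2) hp
      have hnn := Int.emod_nonneg (a 2) hp.ne'
      refine ⟨⟨⟨(a 2 % p 2).toNat, by omega⟩, ⟨e % 2, Nat.mod_lt _ two_pos⟩⟩, ?_⟩
      refine Quotient.sound ((h.std₁.orbits_word_iff _ _ _ _ _).2 ⟨?_, ?_⟩)
      · rw [Pi.single_eq_same]
        simp only
        rw [Int.toNat_of_nonneg hnn]
        exact Int.dvd_self_sub_emod
      · rw [Nat.even_iff]; simp only; omega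

/-- Conjugating the second dihedral group, one can remove the `q`-part from the multipliers. -/
theorem exists_conj_mult_pow {A : Setoid Ω} {i : Fin 3} [Finite Ω]
    (hL : Level G A (orbits {ρ 0, ρ 1}) (p i) (ρ i))
    (hpow : ActsAsPower A (orbits {ρ 0, ρ 1}) (p i) (ρ i) (σ i)) {q : ℕ} (hq : q.Prime)
    (hq2 : Nat.Coprime (p 2 * 2) q) :
    ∃ γ ∈ G, (∀ y, orbits {ρ 0, ρ 1} (γ y) y) ∧ ∃ M : ℕ, ¬ q ∣ M ∧
      ∀ g ∈ Subgroup.closure (Set.range ρ ∪ {τ} ∪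
        (Set.range (fun i => γ * σ i * γ⁻¹) ∪ {γ * τ₂ * γ⁻¹})), ∀ y, hL.mult g y ^ M = 1 := by
  classical
  have : Fact (p i).Prime := ⟨h.prime i⟩
  set B := orbits {ρ 0, ρ 1} with hB
  have : Fintype (Quotient B) := Fintype.ofFinite _
  choose f hf0 hf using hpow
  -- `σ i` acts on the class of `y` as `ρ i ^ f y`. Squaring removes the signs caused by
  -- reflections.
  set F : Ω → ZMod (p i) := fun y => (f y : ZMod (p i)) ^ 2 with hF
  have hF0 : ∀ y, F y ≠ 0 := fun y =>
    pow_ne_zero 2 (by rw [Ne, ZMod.intCast_zmod_eq_zero_iff_dvd]; exact hf0 y)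
  have hFB : ∀ y z, B y z → F y = F z := by
    intro y z hyz
    have : (f y : ZMod (p i)) = f z := by
      rw [hL.intCast_eq_iff y]
      exact A.trans (A.symm (hf y y (B.refl _))) (hf z y hyz)
    simp only [hF, this]
  have hrG : ∀ a e, word ρ τ a e ∈ G := Std.word_mem G h.mem_rot₁ h.mem_refl₁
  have hsG : ∀ a e, word σ τ₂ a e ∈ G := Std.word_mem G h.mem_rot₂ h.mem_refl₂
  have hsign : ∀ e : ℕ, ((((-1 : ℤ) ^ e : ℤ) : ZMod (p i))) ^ 2 = 1 := by
    intro e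
    rw [← Int.cast_pow, ← pow_mul, mul_comm, pow_mul]
    simp
  have hr : ∀ a e y, hL.mult (word ρ τ a e) y ^ 2 = 1 := by
    intro a e y
    rw [hL.mult_eq (hrG a e) (B.refl y) (m := (-1) ^ e), hsign]
    rw [← Equiv.Perm.mul_apply, h.std₁.word_mul_gen]
    exact A.refl _
  -- Conjugation by `s` sends `σ i` to itself or its inverse; comparing exponents on the class of
  -- `y` and on its image gives `m * f y = ± f (s y)`. Thus the squared multiplier of `s` is the
  -- coboundary of `F`.
  have hs : ∀ a e y, hL.mult (word σ τ₂ a e) y ^ 2 * F y = F (word σ τ₂ a e y) := by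
    intro a e y
    set s := word σ τ₂ a e with hsd
    obtain ⟨m, hm, hm'⟩ := hL.exists_mult (hsG a e) y
    have h1 := hL.invA _ (hsG a e) _ _ (hf y y (B.refl _))
    rw [← Equiv.Perm.mul_apply, h.std₂.word_mul_gen, Equiv.Perm.mul_apply] at h1
    have h2 := hL.actsAsPower_zpow (h.mem_rot₂ i) (hf (s y)) ((-1) ^ e) _ (B.refl _)
    have h3 := hL.normalizes_zpow hm' (f y) y (B.refl _)
    have h4 : ((m * f y : ℤ) : ZMod (p i)) = ((f (s y) * (-1) ^ e : ℤ) : ZMod (p i)) := by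
      rw [hL.intCast_eq_iff (s y)]
      exact A.trans (A.symm h3) (A.trans (A.symm h1) h2)
    rw [hm]
    simp only [hF]
    rw [← mul_pow, ← Int.cast_mul, h4, Int.cast_mul, mul_pow, hsign, mul_one]
  set r : Fin (p 2) × Fin 2 → Perm Ω := fun ce =>
    word ρ τ (Pi.single 2 ((ce.1 : ℕ) : ℤ)) (ce.2 : ℕ) with hrd
  set s : Fin (p 2) × Fin 2 → Perm Ω := fun ce =>
    word σ τ₂ (Pi.single 2 ((ce.1 : ℕ) : ℤ)) (ce.2 : ℕ) with hsd
  set k : Fin (p 2) × Fin 2 → Perm Ω := fun ce => (r ce)⁻¹ * s ce with hkd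
  have hkG : ∀ ce, k ce ∈ G := fun ce => G.mul_mem (G.inv_mem (hrG _ _)) (hsG _ _)
  have hkB : ∀ ce y, B (k ce y) y := by
    intro ce y
    have := hL.invB _ (G.inv_mem (hrG (Pi.single 2 ((ce.1 : ℕ) : ℤ)) (ce.2 : ℕ))) _ _
      (h.agree_word y (Pi.single 2 ((ce.1 : ℕ) : ℤ)) (ce.2 : ℕ))
    rwa [perm_inv_apply] at this
  have hk : ∀ ce y, hL.mult (k ce) y ^ 2 * F y = F (r ce y) := by
    intro ce y
    have h1 : hL.mult (s ce) y = hL.mult (r ce) (k ce y) * hL.mult (k ce) y := by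
      rw [← hL.mult_mul (hrG _ _) (hkG ce)]
      change _ = hL.mult (r ce * ((r ce)⁻¹ * s ce)) y
      rw [mul_inv_cancel_left]
    rw [← hFB _ _ (h.agree_word y _ _), ← hs]
    have h2 := hr (Pi.single 2 ((ce.1 : ℕ) : ℤ)) (ce.2 : ℕ) (k ce y)
    change _ = hL.mult (s ce) y ^ 2 * F y
    rw [h1, mul_pow]
    change hL.mult (r ce) (k ce y) ^ 2 = 1 at h2
    rw [h2, one_mul]
  set l : List (Perm Ω) := (Finset.univ : Finset (Fin (p 2) × Fin 2)).toList.map k with hl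
  have hlG : ∀ g ∈ l, g ∈ G ∧ ∀ y, B (g y) y := by
    intro g hg
    obtain ⟨ce, -, rfl⟩ := List.mem_map.1 hg
    exact ⟨hkG ce, hkB ce⟩
  set N := p 2 * 2 with hN
  -- In the product of `hk` over all `ce` the classes of `r ce y` run once through all classes, so
  -- the right side becomes the product of `F` over all classes and no longer depends on `y`.
  obtain ⟨P, hP⟩ : ∃ P : ZMod (p i), ∀ y, hL.mult l.prod y ^ 2 * F y ^ N = P := by
    refine ⟨∏ q : Quotient B, Quotient.lift F hFB q, fun y => ?_⟩
    rw [(hL.mult_list_prod l hlG y).2.2, hl, List.map_map, Finset.prod_map_toList]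
    have hcard : F y ^ N = ∏ _ce : Fin (p 2) × Fin 2, F y := by
      simp [Finset.prod_const, hN]
    rw [hcard, ← Finset.prod_pow, ← Finset.prod_mul_distrib]
    exact Fintype.prod_bijective _ (h.bijective_class y) _ _ (fun ce => hk ce y)
  rcases isEmpty_or_nonempty Ω with hΩ | ⟨⟨x⟩⟩
  · refine ⟨1, G.one_mem, fun y => B.refl _, 1, hq.one_lt.ne' ∘ Nat.dvd_one.1, fun g _ y => ?_⟩
    exact hΩ.elim y
  obtain ⟨hγ₀, hγ₀B, -⟩ := hL.mult_list_prod l hlG x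
  obtain ⟨n, M, hM, hnM⟩ := Nat.exists_eq_pow_mul_and_not_dvd
    (n := p i - 1) (by have := (h.prime i).two_le; omega) q hq.ne_one
  -- `q ^ n` is the `q`-part of `p i - 1`. Raising to the power `a` replaces `F ^ N` by `F` times `F
  -- ^ (q ^ n * t)`, and the latter has order dividing `M`, which is prime to `q`.
  obtain ⟨a, t, hat⟩ := exists_mul_eq_one_add hq2 n hq.one_lt
  have hγG : l.prod ^ a ∈ G := G.pow_mem hγ₀ a
  have hγB : ∀ y, B ((l.prod ^ a) y) y := by
    have := hL.mult_list_prod (List.replicate a l.prod)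
      (fun k' hk' => by rw [List.eq_of_mem_replicate hk']; exact ⟨hγ₀, hγ₀B⟩)
    intro y
    simpa using (this y).2.1 y
  have hγ : ∀ y, hL.mult (l.prod ^ a) y ^ 2 * F y ^ (1 + q ^ n * t) = P ^ a := by
    intro y
    rw [hL.mult_pow hγ₀ hγ₀B, ← hat, pow_mul, ← hP y, mul_pow]
    ring
  set γ := l.prod ^ a with hγd
  refine ⟨γ, hγG, hγB, 2 * M, ?_, ?_⟩
  · intro hd
    rcases (hq.dvd_mul).1 hd with hd | hd
    · have := Nat.dvd_gcd (hd.mul_left (p 2)) dvd_rfl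
      rw [hq2.gcd_eq_one] at this
      exact hq.one_lt.ne' (Nat.dvd_one.1 this)
    · exact hM hd
  · have hcσ : ∀ a e y, hL.mult (γ * word σ τ₂ a e * γ⁻¹) y ^ (2 * M) = 1 := by
      intro b e y
      have e1 : hL.mult (γ * word σ τ₂ b e * γ⁻¹) y * hL.mult γ (γ⁻¹ y) =
          hL.mult γ (word σ τ₂ b e (γ⁻¹ y)) * hL.mult (word σ τ₂ b e) (γ⁻¹ y) := by
        rw [← hL.mult_mul hγG (hsG b e)]
        have := hL.mult_mul (G.mul_mem (G.mul_mem hγG (hsG b e)) (G.inv_mem hγG)) hγG (γ⁻¹ y)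
        rw [inv_mul_cancel_right, perm_apply_inv] at this
        exact this.symm
      set u := γ⁻¹ y with hu
      set v := word σ τ₂ b e u with hv
      have hmu := hL.mult_ne_zero hγG u
      have e2 := congrArg (· ^ 2) e1
      simp only [mul_pow] at e2
      have e3 := hs b e u
      have e4 : hL.mult γ v ^ 2 * F v ^ (1 + q ^ n * t) = hL.mult γ u ^ 2 * F u ^ (1 + q ^ n * t) :=
        (hγ v).trans (hγ u).symm
      set X := hL.mult (γ * word σ τ₂ b e * γ⁻¹) y ^ 2 with hX
      -- The conjugation by `γ` cancels the coboundary of `F` and leaves only that of `F ^ (q ^ n *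
      -- t)`, which the exponent `M` kills.
      have e5 : X * F v ^ (q ^ n * t) = F u ^ (q ^ n * t) := by
        have hne : hL.mult γ u ^ 2 * F u * F v ≠ 0 :=
          mul_ne_zero (mul_ne_zero (pow_ne_zero _ hmu) (hF0 _)) (hF0 _)
        apply mul_right_cancel₀ hne
        calc X * F v ^ (q ^ n * t) * (hL.mult γ u ^ 2 * F u * F v)
            = (X * hL.mult γ u ^ 2) * F u * F v ^ (1 + q ^ n * t) := by ring
          _ = (hL.mult (word σ τ₂ b e) u ^ 2 * F u) *
              (hL.mult γ v ^ 2 * F v ^ (1 + q ^ n * t)) := by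
            rw [e2]; ring
          _ = _ := by rw [e3, e4]; ring
      have hfer : ∀ z, (F z ^ (q ^ n * t)) ^ M = 1 := by
        intro z
        have : F z ^ (p i - 1) = 1 := ZMod.pow_card_sub_one_eq_one (hF0 z)
        rw [← pow_mul, show q ^ n * t * M = (q ^ n * M) * t by ring, ← hnM, pow_mul, this, one_pow]
      have e6 := congrArg (· ^ M) e5
      simp only [mul_pow, hfer, mul_one] at e6
      rw [pow_mul]
      exact e6
    have hgen : ∀ g ∈ Set.range ρ ∪ {τ} ∪
        (Set.range (fun i => γ * σ i * γ⁻¹) ∪ {γ * τ₂ * γ⁻¹}),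
        g ∈ G ∧ ∀ y, hL.mult g y ^ (2 * M) = 1 := by
      have hw : ∀ (ρ : Fin 3 → Perm Ω) (τ : Perm Ω) j, ρ j = word ρ τ (Pi.single j 1) 0 := by
        intro ρ τ j
        rw [word, rot_single, zpow_one, pow_zero, mul_one]
      have hw' : ∀ (ρ : Fin 3 → Perm Ω) (τ : Perm Ω), τ = word ρ τ 0 1 := by
        intro ρ τ
        rw [word, rot_zero, pow_one, one_mul]
      rintro g ((⟨j, rfl⟩ | rfl) | (⟨j, rfl⟩ | rfl))
      · refine ⟨h.mem_rot₁ j, fun y => ?_⟩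
        rw [hw ρ τ j, pow_mul, hr, one_pow]
      · refine ⟨h.mem_refl₁, fun y => ?_⟩
        rw [hw' ρ g, pow_mul, hr, one_pow]
      · refine ⟨G.mul_mem (G.mul_mem hγG (h.mem_rot₂ j)) (G.inv_mem hγG), fun y => ?_⟩
        have := hcσ (Pi.single j 1) 0 y
        rwa [← hw] at this
      · refine ⟨G.mul_mem (G.mul_mem hγG h.mem_refl₂) (G.inv_mem hγG), fun y => ?_⟩
        have := hcσ 0 1 y
        rwa [← hw'] at this
    intro g hg
    suffices g ∈ G ∧ ∀ y, hL.mult g y ^ (2 * M) = 1 from this.2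
    induction hg using Subgroup.closure_induction with
    | mem g hg => exact hgen g hg
    | one => exact ⟨G.one_mem, fun y => by rw [hL.mult_one, one_pow]⟩
    | mul g k _ _ h1 h2 =>
      refine ⟨G.mul_mem h1.1 h2.1, fun y => ?_⟩
      rw [hL.mult_mul h1.1 h2.1, mul_pow, h1.2, h2.2, mul_one]
    | inv g _ h1 =>
      refine ⟨G.inv_mem h1.1, fun y => ?_⟩
      have := congrArg (· ^ (2 * M)) (hL.mult_inv h1.1 y)
      simpa [mul_pow, h1.2] using this

end Config

/-! ### Agreement of the two groups on a coupling class. -/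

section Matching

variable {Ω : Type*} {G : Subgroup (Perm Ω)}

namespace Level

variable {A B : Setoid Ω} {ℓ : ℕ} {ρ : Perm Ω} (h : Level G A B ℓ ρ)
include h

/-- Powers of `ρ` commute with `ρ`. Being a translation, `σ` acts with one and the same exponent on
coupled points, so `σ = ρ` at `x` spreads to its coupling class. -/
theorem actsAsPower_mem_translations {σ : Perm Ω} (hσ : σ ∈ G) (hpow : ActsAsPower A B ℓ ρ σ) :
    σ ∈ h.translations := by
  refine ⟨hσ, fun y => ?_⟩
  obtain ⟨j, -, hj⟩ := hpow y
  refine ⟨B.trans (h.le _ _ (hj y (B.refl _))) (h.step_zpow _ _), ?_⟩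
  refine A.trans (hj _ (h.step y)) ?_
  rw [← Equiv.Perm.mul_apply, ((Commute.refl ρ).zpow_left j).eq]
  exact h.invA _ h.mem _ _ (A.symm (hj y (B.refl _)))

theorem zpow_base {σ : Perm Ω} (hσ : σ ∈ G) (hpow : ActsAsPower A B ℓ ρ σ) {x : Ω}
    (hx : A (σ x) (ρ x)) (n : ℤ) : A ((σ ^ n) x) ((ρ ^ n) x) := by
  obtain ⟨j, -, hj⟩ := hpow x
  have h1 : A ((ρ ^ j) x) ((ρ ^ (1 : ℤ)) x) := by
    rw [zpow_one]
    exact A.trans (A.symm (hj x (B.refl _))) hx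
  rw [h.zpow_congr] at h1
  refine A.trans (h.actsAsPower_zpow hσ hj n x (B.refl _)) (h.zpow_congr.2 ?_)
  rw [show j * n - n = (j - 1) * n by ring]
  exact h1.mul_right _

/-- If `s` commutes with an element acting as a power of `ρ` and fixes the class of `y`, then it
commutes with `ρ` there. -/
theorem comm_of_commute {σ s : Perm Ω} (hpow : ActsAsPower A B ℓ ρ σ) (hs : s ∈ G)
    (hsσ : Commute s σ) {y : Ω} (hy : B (s y) y) : A (s (ρ y)) (ρ (s y)) := by
  obtain ⟨j, hj0, hj⟩ := hpow y
  obtain ⟨m, hm⟩ := h.norm s hs y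
  have h1 := h.invA _ hs _ _ (hj y (B.refl _))
  rw [← Equiv.Perm.mul_apply, hsσ.eq] at h1
  have h2 : A ((ρ ^ j) (s y)) ((ρ ^ (m * j)) (s y)) :=
    A.trans (A.symm (hj _ hy)) (A.trans h1 (h.normalizes_zpow hm j y (B.refl _)))
  rw [h.zpow_congr, show j - m * j = (1 - m) * j by ring] at h2
  have h3 := (Int.Prime.dvd_mul' h.prime h2).resolve_right hj0
  refine A.trans (hm y (B.refl _)) (A.symm ?_)
  have := (h.zpow_congr (a := 1) (b := m) (y := s y)).2 h3
  rwa [zpow_one] at this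

/-- If `s` and `r` invert or centralize `σ` and `ρ` in the same way, and `σ` agrees with `ρ` on
the coupling class of `x`, then `r⁻¹ * s` commutes with `ρ` on this class. -/
theorem comm_of_coupled {σ s r : Perm Ω} (hσ : σ ∈ G) (hpow : ActsAsPower A B ℓ ρ σ)
    (hs : s ∈ G) (hr : r ∈ G) {ε : ℤ} (hsσ : s * σ = σ ^ ε * s) (hrρ : r * ρ = ρ ^ ε * r) {x y : Ω}
    (hx : A (σ x) (ρ x)) (hsx : h.Coupled x (s x)) (hy : h.Coupled x y) :
    A ((r⁻¹ * s) (ρ y)) (ρ ((r⁻¹ * s) y)) := by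
  have hT := h.actsAsPower_mem_translations hσ hpow
  have h1 : A (σ y) (ρ y) := by
    have := h.translation_eq_zpow hT hy (j := 1) (by simpa using hx)
    simpa using this
  have h2 : A ((σ ^ ε) (s y)) ((ρ ^ ε) (s y)) :=
    h.translation_eq_zpow (h.translations.zpow_mem hT ε)
      (hsx.trans (h.coupled_apply hy hs)) (h.zpow_base hσ hpow hx ε)
  have h3 : A (s (ρ y)) ((ρ ^ ε) (s y)) := by
    refine A.trans (A.symm (h.invA _ hs _ _ h1)) ?_
    rw [← Equiv.Perm.mul_apply, hsσ]
    exact h2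
  have h4 := h.invA _ (G.inv_mem hr) _ _ h3
  have h5 : r⁻¹ * ρ ^ ε = ρ * r⁻¹ := by
    rw [inv_mul_eq_iff_eq_mul, ← mul_assoc, hrρ, mul_inv_cancel_right]
  rw [← Equiv.Perm.mul_apply r⁻¹ (ρ ^ ε), h5] at h4
  exact h4

end Level

variable {p : Fin 3 → ℕ} {ρ σ : Fin 3 → Perm Ω} {τ τ₂ : Perm Ω}

theorem word_rot (ρ : Fin 3 → Perm Ω) (τ : Perm Ω) (i : Fin 3) (n : ℤ) :
    word ρ τ (Pi.single i n) 0 = ρ i ^ n := by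
  rw [word, rot_single, pow_zero, mul_one]

theorem Std.rot_eq_zpow (h : Std p ρ τ) (i : Fin 3) {a : Fin 3 → ℤ}
    (ha : ∀ j, j ≠ i → (p j : ℤ) ∣ a j) : rot ρ a = ρ i ^ a i := by
  rw [← rot_single, ← mul_inv_eq_one, ← h.rot_neg, ← h.rot_add]
  have := h.word_eq_one (a := a + -Pi.single i (a i)) (e := 0) (fun j => ?_) Even.zero
  · simpa [word] using this
  · rcases eq_or_ne j i with rfl | hj
    · simp
    · simpa [hj] using ha j hj

/-- Agreement modulo `A` of corresponding elements of the two dihedral groups on the points of a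
class `{y | C x y}`, provided that elements of the two groups that agree at `x` agree on the whole
class. -/
structure Matching (G : Subgroup (Perm Ω)) (ρ : Fin 3 → Perm Ω) (τ : Perm Ω)
    (σ : Fin 3 → Perm Ω) (τ₂ : Perm Ω) (A : Setoid Ω) (C : Ω → Ω → Prop) (x : Ω) : Prop where
  refl : ∀ y, C y y
  symm : ∀ y z, C y z → C z y
  trans : ∀ y z w, C y z → C z w → C y w
  apply : ∀ g ∈ G, ∀ y z, C y z → C (g y) (g z)
  inv : ∀ g ∈ G, ∀ y z, A y z → A (g y) (g z)
  spread : ∀ a e b f, C x (word σ τ₂ a e x) → A (word ρ τ b f x) (word σ τ₂ a e x) →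
    ∀ y, C x y → A (word ρ τ b f y) (word σ τ₂ a e y)

theorem neg_one_pow_eq {e f : ℕ} (hef : Even (f + e)) : (-1 : ℤ) ^ f = (-1) ^ e := by
  rcases Nat.even_or_odd e with he | he
  · rw [he.neg_one_pow, ((Nat.even_add.1 hef).2 he).neg_one_pow]
  · rw [he.neg_one_pow, (Nat.not_even_iff_odd.1 fun hf =>
      Nat.not_even_iff_odd.2 he ((Nat.even_add.1 hef).1 hf)).neg_one_pow]

namespace Config

variable (h : Config p G ρ τ σ τ₂)
include h

theorem word_mem₁ (a : Fin 3 → ℤ) (e : ℕ) : word ρ τ a e ∈ G :=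
  Std.word_mem G h.mem_rot₁ h.mem_refl₁ a e

theorem word_mem₂ (a : Fin 3 → ℤ) (e : ℕ) : word σ τ₂ a e ∈ G :=
  Std.word_mem G h.mem_rot₂ h.mem_refl₂ a e

theorem isCoprime {i j : Fin 3} (hij : i ≠ j) : IsCoprime (p i : ℤ) (p j) := by
  rw [Nat.isCoprime_iff_coprime]
  exact (Nat.coprime_primes (h.prime i) (h.prime j)).2 (h.inj.ne hij)

theorem even_of_agree {x : Ω} {a b : Fin 3 → ℤ} {e f : ℕ}
    (hx : orbits {ρ 0, ρ 1} (word ρ τ b f x) (word σ τ₂ a e x)) :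
    (p 2 : ℤ) ∣ a 2 - b 2 ∧ Even (f + e) :=
  (h.std₁.orbits_word_iff x b a f e).1
    ((orbits {ρ 0, ρ 1}).trans' hx (h.agree_word x a e))

/-- The rotations of order `p 2` agree on a matching class. -/
theorem matching_rot_two {A : Setoid Ω} {C : Ω → Ω → Prop} {x : Ω}
    (hM : Matching G ρ τ σ τ₂ A C x) (n : ℤ) (hn : C x ((σ 2 ^ n) x)) :
    A ((ρ 2 ^ n) x) ((σ 2 ^ n) x) := by
  -- This is the element of the first group that agrees with `σ 2 ^ n` at `x`. It is a rotation, and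
  -- spreading makes its powers agree with those of `σ 2 ^ n` modulo `A` at `x`.
  obtain ⟨b, f, hbf⟩ := h.std₁.trans x ((σ 2 ^ n) x)
  rw [← word_rot σ τ₂] at hn hbf
  have hpar := h.even_of_agree (b := b) (f := f) (x := x) (by rw [hbf])
  have hf : Even f := by simpa using hpar.2
  have hw : word ρ τ b f = rot ρ b := by
    have := h.std₁.word_eq_one (a := 0) (e := f) (fun _ => dvd_zero _) hf
    rw [word, rot_zero, one_mul] at this
    rw [word, this, mul_one]
  have hs := hM.spread _ _ b f hn (by rw [← hbf])
  rw [hw, word_rot] at hs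
  rw [word_rot] at hn hbf
  rw [hw] at hbf
  have hσ : ∀ k : ℕ, C x (((σ 2 ^ n) ^ k) x) := by
    intro k
    induction k with
    | zero => exact hM.refl x
    | succ k ih =>
      rw [pow_succ']
      exact hM.trans _ _ _ hn (hM.apply _ (G.zpow_mem (h.mem_rot₂ 2) n) _ _ ih)
  have hk : ∀ k : ℕ, A ((rot ρ b ^ k) x) (((σ 2 ^ n) ^ k) x) := by
    intro k
    induction k with
    | zero => exact A.refl _
    | succ k ih =>
      rw [pow_succ', pow_succ']
      have hb := h.word_mem₁ b 0
      rw [word, pow_zero, mul_one] at hb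
      exact A.trans (hM.inv _ hb _ _ ih) (hs _ (hσ k))
  -- Modulo `p 2` the third exponent of `b` is `n`, so `rot ρ b'` has order dividing `p 0 * p 1`. It
  -- is the discrepancy between the two rotations and has to fix the `A`-class of `x`.
  set b' : Fin 3 → ℤ := b - Pi.single 2 n with hb'
  have hb2 : (p 2 : ℤ) ∣ b' 2 := by
    have := hpar.1
    rw [Pi.single_eq_same, ← dvd_neg, neg_sub] at this
    simpa [hb'] using this
  have hbb : rot ρ b = ρ 2 ^ n * rot ρ b' := by
    rw [← rot_single, ← h.std₁.rot_add, hb']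
    congr 1; abel
  have hstab : A (rot ρ b' x) x := by
    have h1 := hk (p 2)
    rw [← zpow_natCast (σ 2 ^ n), ← zpow_mul, mul_comm, zpow_mul, zpow_natCast, h.std₂.pow,
      one_zpow, ← zpow_natCast, ← h.std₁.rot_zsmul] at h1
    have h2 : rot ρ ((p 2 : ℤ) • b) = rot ρ ((p 2 : ℤ) • b') := by
      rw [← mul_inv_eq_one, ← h.std₁.rot_neg, ← h.std₁.rot_add, hb']
      have := h.std₁.word_eq_one (a := (p 2 : ℤ) • Pi.single 2 n) (e := 0) (fun j => by
        rw [Pi.smul_apply, smul_eq_mul]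
        rcases eq_or_ne j 2 with rfl | hj
        · exact dvd_mul_right _ _
        · rw [Pi.single_eq_of_ne hj, mul_zero]; exact dvd_zero _) Even.zero
      rw [word, pow_zero, mul_one] at this
      rw [← this]
      congr 1
      rw [smul_sub]; abel
    rw [h2] at h1
    have h3 : ∀ m : ℕ, A ((rot ρ ((p 2 : ℤ) • b') ^ m) x) x := by
      intro m
      induction m with
      | zero => exact A.refl _
      | succ m ih =>
        rw [pow_succ']
        have hb := h.word_mem₁ ((p 2 : ℤ) • b') 0
        rw [word, pow_zero, mul_one] at hb
        exact A.trans (hM.inv _ hb _ _ ih) h1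
    -- The `p 2`-th power of `rot ρ b'` fixes the class of `x`, and `rot ρ b'` is a power of it
    -- because `p 2` is invertible modulo `p 0 * p 1`.
    have hcop : Nat.Coprime (p 2) (p 0 * p 1) :=
      Nat.Coprime.mul_right ((Nat.coprime_primes (h.prime _) (h.prime _)).2 (h.inj.ne (by decide)))
        ((Nat.coprime_primes (h.prime _) (h.prime _)).2 (h.inj.ne (by decide)))
    obtain ⟨m, -, hm⟩ := Nat.exists_mul_mod_eq_one_of_coprime hcop
      (one_lt_mul'' (h.prime 0).one_lt (h.prime 1).one_lt)
    have h4 : (p 0 * p 1 : ℤ) ∣ p 2 * m - 1 := by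
      have := Nat.mod_add_div (p 2 * m) (p 0 * p 1)
      rw [hm] at this
      refine ⟨(p 2 * m / (p 0 * p 1) : ℕ), ?_⟩
      have h5 : ((p 2 * m : ℕ) : ℤ) = _ := congrArg Nat.cast this.symm
      push_cast at h5 ⊢
      linarith
    have h6 : rot ρ ((p 2 : ℤ) • b') ^ m = rot ρ b' := by
      rw [← zpow_natCast, ← h.std₁.rot_zsmul, ← mul_inv_eq_one, ← h.std₁.rot_neg, ← h.std₁.rot_add]
      have := h.std₁.word_eq_one (a := (m : ℤ) • (p 2 : ℤ) • b' + -b') (e := 0) (fun j => by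
        have : ((m : ℤ) • (p 2 : ℤ) • b' + -b') j = (p 2 * m - 1) * b' j := by
          simp only [Pi.add_apply, Pi.smul_apply, Pi.neg_apply, smul_eq_mul]; ring
        rw [this]
        fin_cases j
        · exact ((dvd_mul_right _ _).trans h4).mul_right _
        · exact ((dvd_mul_left _ _).trans h4).mul_right _
        · exact hb2.mul_left _) Even.zero
      rwa [word, pow_zero, mul_one] at this
    have := h3 m
    rwa [h6] at this
  rw [hbf, hbb]
  exact A.symm (hM.inv _ (G.zpow_mem (h.mem_rot₁ 2) n) _ _ hstab)

/-- If the rotations of prime order and one reflection are matched, everything is matched. -/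
theorem matching {A : Setoid Ω} {C : Ω → Ω → Prop} {x : Ω}
    (hM : Matching G ρ τ σ τ₂ A C x)
    (h0 : ∀ n : ℤ, C x ((σ 0 ^ n) x) → A ((ρ 0 ^ n) x) ((σ 0 ^ n) x))
    (h1 : ∀ n : ℤ, C x ((σ 1 ^ n) x) → A ((ρ 1 ^ n) x) ((σ 1 ^ n) x))
    (hrefl : ∀ a, C x (word σ τ₂ a 1 x) →
      ∃ b, C x (word σ τ₂ b 1 x) ∧ A (word ρ τ b 1 x) (word σ τ₂ b 1 x))
    (a : Fin 3 → ℤ) (e : ℕ) (ha : C x (word σ τ₂ a e x)) :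
    A (word ρ τ a e x) (word σ τ₂ a e x) := by
  have hmul : ∀ a e b f, C x (word σ τ₂ a e x) → A (word ρ τ a e x) (word σ τ₂ a e x) →
      C x (word σ τ₂ b f x) → A (word ρ τ b f x) (word σ τ₂ b f x) →
      A ((word ρ τ a e * word ρ τ b f) x) ((word σ τ₂ a e * word σ τ₂ b f) x) := by
    intro a e b f h1 h2 h3 h4
    exact A.trans (hM.inv _ (h.word_mem₁ a e) _ _ h4) (hM.spread a e a e h1 h2 _ h3)
  have hCmul : ∀ g ∈ G, ∀ k, C x (g x) → C x (k x) → C x ((g * k) x) := by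
    intro g hg k h1 h2
    exact hM.trans _ _ _ h1 (hM.apply g hg _ _ h2)
  have hCinv : ∀ g ∈ G, C x (g x) → C x (g⁻¹ x) := by
    intro g hg h1
    have := hM.apply _ (G.inv_mem hg) _ _ (hM.symm _ _ h1)
    rwa [perm_inv_apply] at this
  have hCzpow : ∀ g ∈ G, C x (g x) → ∀ n : ℤ, C x ((g ^ n) x) := by
    intro g hg h1 n
    induction n using Int.induction_on with
    | zero => exact hM.refl x
    | succ n ih => rw [zpow_add_one]; exact hCmul _ (G.zpow_mem hg _) _ ih h1
    | pred n ih => rw [zpow_sub_one]; exact hCmul _ (G.zpow_mem hg _) _ ih (hCinv g hg h1)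
  have hprime : ∀ i, ∀ n : ℤ, C x ((σ i ^ n) x) → A ((ρ i ^ n) x) ((σ i ^ n) x) := by
    intro i
    fin_cases i
    · exact h0
    · exact h1
    · exact h.matching_rot_two hM
  have hrot : ∀ a, C x (word σ τ₂ a 0 x) → A (word ρ τ a 0 x) (word σ τ₂ a 0 x) := by
    intro a ha
    have key : ∀ (i : Fin 3) (n : ℤ), (∀ j, j ≠ i → (p j : ℤ) ∣ n) →
        C x (word σ τ₂ (n • a) 0 x) ∧ A (word ρ τ (n • a) 0 x) (word σ τ₂ (n • a) 0 x) := by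
      intro i n hn
      have hd : ∀ j, j ≠ i → (p j : ℤ) ∣ (n • a) j := fun j hj => (hn j hj).mul_right _
      have hC : C x (word σ τ₂ (n • a) 0 x) := by
        have := hCzpow _ (h.word_mem₂ a 0) ha n
        rw [word, pow_zero, mul_one] at this ⊢
        rwa [h.std₂.rot_zsmul]
      refine ⟨hC, ?_⟩
      simp only [word, pow_zero, mul_one] at hC ⊢
      rw [h.std₁.rot_eq_zpow i hd]
      rw [h.std₂.rot_eq_zpow i hd] at hC ⊢
      exact hprime i _ hC
    -- Two Bézout identities write 1 as a sum of three integers, each divisible by all but one of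
    -- the primes; this splits a rotation into powers of `σ 0`, `σ 1` and `σ 2`.
    obtain ⟨u, v, huv⟩ := (h.isCoprime (show (0 : Fin 3) ≠ 1 by decide)).mul_right
      (h.isCoprime (show (0 : Fin 3) ≠ 2 by decide))
    obtain ⟨s, t, hst⟩ := h.isCoprime (show (1 : Fin 3) ≠ 2 by decide)
    have k0 := key 0 (v * (p 1 * p 2)) (fun j hj => by
      fin_cases j
      · exact absurd rfl hj
      · exact ⟨v * p 2, by simp; ring⟩
      · exact ⟨v * p 1, by simp; ring⟩)
    have k1 := key 1 (u * p 0 * (t * p 2)) (fun j hj => by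
      fin_cases j
      · exact ⟨u * t * p 2, by simp; ring⟩
      · exact absurd rfl hj
      · exact ⟨u * p 0 * t, by simp; ring⟩)
    have k2 := key 2 (u * p 0 * (s * p 1)) (fun j hj => by
      fin_cases j
      · exact ⟨u * s * p 1, by simp; ring⟩
      · exact ⟨u * p 0 * s, by simp; ring⟩
      · exact absurd rfl hj)
    have hsum : a = (v * (p 1 * p 2)) • a +
        ((-1 : ℤ) ^ 0 • (u * p 0 * (t * p 2)) • a + (-1 : ℤ) ^ 0 • (u * p 0 * (s * p 1)) • a) := by
      rw [pow_zero, one_smul, one_smul, ← add_smul, ← add_smul]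
      have : v * (p 1 * p 2) + (u * p 0 * (t * p 2) + u * p 0 * (s * p 1)) = (1 : ℤ) := by
        linear_combination huv + u * p 0 * hst
      rw [this, one_smul]
    have m12 := hmul _ _ _ _ k1.1 k1.2 k2.1 k2.2
    have c12 := hCmul _ (h.word_mem₂ _ _) _ k1.1 k2.1
    rw [h.std₁.word_mul, h.std₂.word_mul] at m12
    rw [h.std₂.word_mul] at c12
    have m := hmul _ _ _ _ k0.1 k0.2 c12 m12
    rw [h.std₁.word_mul, h.std₂.word_mul] at m
    simp only [pow_zero, one_smul, add_zero] at m hsum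
    rw [← hsum] at m
    exact m
  have hpar : ∀ {ρ : Fin 3 → Perm Ω} {τ : Perm Ω} (_ : Std p ρ τ) (a : Fin 3 → ℤ) (e : ℕ),
      word ρ τ a e = word ρ τ a (e % 2) := by
    intro ρ τ hS a e
    conv_lhs => rw [word, ← Nat.div_add_mod e 2, pow_add, pow_mul, hS.sq, one_pow, one_mul]
    rfl
  rw [hpar h.std₂] at ha ⊢
  rw [hpar h.std₁]
  rcases Nat.mod_two_eq_zero_or_one e with he | he
  · rw [he] at ha ⊢
    exact hrot a ha
  · rw [he] at ha ⊢
    obtain ⟨b, hb, hbA⟩ := hrefl a ha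
    have hc : C x (word σ τ₂ ((-1 : ℤ) ^ 1 • (a - b)) 0 x) := by
      have := hCmul _ (G.inv_mem (h.word_mem₂ b 1)) _ (hCinv _ (h.word_mem₂ b 1) hb) ha
      rw [h.std₂.word_inv_mul, hpar h.std₂] at this
      exact this
    have := hmul _ _ _ _ hb hbA hc (hrot _ hc)
    rw [h.std₁.word_mul, h.std₂.word_mul] at this
    simpa using this

end Config

end Matching

/-! ### Moving uncoupled points, adjusting the reflection, and the first case. -/

section Cases

variable {Ω : Type*} {G : Subgroup (Perm Ω)}

/-- A power, with exponent prime to `q`, of every element of `G` that fixes all `B`-classes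
commutes with `ρ` modulo `A`. -/
def Torsion (G : Subgroup (Perm Ω)) (A B : Setoid Ω) (ρ : Perm Ω) (q : ℕ) : Prop :=
  ∃ M : ℕ, ¬ q ∣ M ∧ ∀ k ∈ G, (∀ y, B (k y) y) → ∀ y, A ((k ^ M) (ρ y)) (ρ ((k ^ M) y))

theorem Torsion.mono {H : Subgroup (Perm Ω)} {A B : Setoid Ω} {ρ : Perm Ω} {q : ℕ}
    (h : Torsion G A B ρ q) (hH : H ≤ G) : Torsion H A B ρ q := by
  obtain ⟨M, hM, hk⟩ := h
  exact ⟨M, hM, fun k hkH => hk k (hH hkH)⟩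

namespace Level

variable {A B : Setoid Ω} {ℓ : ℕ} {ρ : Perm Ω} (h : Level G A B ℓ ρ)
include h

theorem exists_pow_mem_translations {q : ℕ} (ht : Torsion G A B ρ q) :
    ∃ M : ℕ, ¬ q ∣ M ∧ ∀ k ∈ G, (∀ y, B (k y) y) → k ^ M ∈ h.translations := by
  obtain ⟨M, hM, hk⟩ := ht
  refine ⟨M, hM, fun k hkG hkB => ⟨G.pow_mem hkG M, fun y => ⟨?_, hk k hkG hkB y⟩⟩⟩
  clear hk hM
  induction M with
  | zero => exact B.refl _
  | succ n ih =>
    rw [pow_succ', Equiv.Perm.mul_apply]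
    exact B.trans (hkB _) ih

theorem coupled_zpow {x : Ω} {g : Perm Ω} (hg : g ∈ G) (hx : h.Coupled x (g x)) (n : ℤ) :
    h.Coupled x ((g ^ n) x) := by
  have hinv : h.Coupled x (g⁻¹ x) := by
    have := h.coupled_apply hx.symm (G.inv_mem hg)
    rwa [perm_inv_apply] at this
  induction n using Int.induction_on with
  | zero => exact Coupled.refl x
  | succ n ih =>
    rw [zpow_add_one]
    exact ih.trans (h.coupled_apply hx (G.zpow_mem hg _))
  | pred n ih =>
    rw [zpow_sub_one]
    exact ih.trans (h.coupled_apply hinv (G.zpow_mem hg _))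

/-- Two independent levels: an uncoupled class can be moved along the orbits of `ρ` by elements
fixing `x`. -/
theorem exists_move {A' : Setoid Ω} {ℓ' : ℕ} {ρ' : Perm Ω} (h' : Level G A' B ℓ' ρ')
    (hAA : ∀ y z, A y z → A' y z → y = z) (hA' : ∀ y, A' (ρ y) y)
    (ht : Torsion G A' B ρ' ℓ) (hℓ : ℓ ≠ ℓ') {x z : Ω} (hz : ¬ h.Coupled x z) (b : ℤ) :
    ∃ t ∈ G, t x = x ∧ t z = (ρ ^ b) z := by
  have hA'z : ∀ (n : ℤ) y, A' ((ρ ^ n) y) y := by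
    intro n y
    induction n using Int.induction_on with
    | zero => exact A'.refl _
    | succ n ih =>
      rw [add_comm, zpow_add, zpow_one]
      exact A'.trans (hA' _) ih
    | pred n ih =>
      rw [sub_eq_neg_add, zpow_add, zpow_neg_one, Equiv.Perm.mul_apply]
      refine A'.trans (A'.symm ?_) ih
      have := hA' (ρ⁻¹ ((ρ ^ (-n : ℤ)) y))
      rwa [perm_apply_inv] at this
  obtain ⟨M, hM, hMT⟩ := h'.exists_pow_mem_translations ht
  have hN : ¬ (ℓ : ℤ) ∣ ((M * ℓ' : ℕ) : ℤ) := by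
    rw [Int.natCast_dvd_natCast, h.prime.dvd_mul]
    rintro (hd | hd)
    · exact hM hd
    · exact hℓ ((Nat.prime_dvd_prime_iff_eq h.prime h'.prime).1 hd)
  obtain ⟨m, hm⟩ := h.exists_inv_mod hN
  -- `t ^ M` is a translation of the other level, so `t ^ (M * ℓ')` fixes every `A'`-class. Since
  -- `m` inverts this exponent modulo `ℓ`, the shift of `z` ends up as `b`.
  obtain ⟨t, htT, htx, htz⟩ := h.exists_translation_of_not_coupled hz (h.step_zpow (m * b) z)
  have hpow : ∀ y, A' ((t ^ (M * ℓ')) y) y := by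
    intro y
    rw [pow_mul]
    exact h'.translation_pow_prime (hMT t htT.1 fun u => (htT.2 u).1) y
  refine ⟨t ^ (M * ℓ'), G.pow_mem htT.1 _, hAA _ _ ?_ (hpow x), hAA _ _ ?_ ?_⟩
  · have := h.translation_pow htT (y := x) (j := 0) (by simpa using htx) (M * ℓ')
    simpa using this
  · refine A.trans (h.translation_pow htT htz _) (h.zpow_congr.2 ?_)
    rw [show m * b * ((M * ℓ' : ℕ) : ℤ) - b = (((M * ℓ' : ℕ) : ℤ) * m - 1) * b by ring]
    exact hm.mul_right _
  · exact A'.trans (hpow z) (A'.symm (hA'z b z))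

end Level

variable {p : Fin 3 → ℕ} {ρ σ : Fin 3 → Perm Ω} {τ τ₂ : Perm Ω}

theorem Std.word_retwist (h : Std p ρ τ) (i : Fin 3) (n : ℤ) (a : Fin 3 → ℤ) (e : ℕ) :
    word ρ (ρ i ^ n * τ) a e = word ρ τ (Pi.single i (if Even e then 0 else n) + a) e := by
  have hsq : (ρ i ^ n * τ) ^ 2 = 1 := by
    rw [pow_two, mul_assoc, ← mul_assoc τ, h.refl_mul_zpow, mul_assoc, ← pow_two, h.sq, mul_one,
      ← zpow_add, add_neg_cancel, zpow_zero]
  rcases Nat.even_or_odd' e with ⟨k, rfl | rfl⟩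
  · rw [if_pos (even_two_mul k), Pi.single_zero, zero_add, word, word, pow_mul, pow_mul, hsq, h.sq]
  · rw [if_neg (Nat.not_even_iff_odd.2 (odd_two_mul_add_one k)), word, word, pow_succ, pow_succ,
      pow_mul, pow_mul, hsq, h.sq, h.rot_add, rot_single, one_pow, one_mul, one_mul, ← mul_assoc,
      ← rot_single, h.rot_comm]

theorem Std.word_single_add (h : Std p ρ τ) (i : Fin 3) (n : ℤ) (a : Fin 3 → ℤ) (e : ℕ) :
    word ρ τ (Pi.single i n + a) e = ρ i ^ n * word ρ τ a e := by
  rw [word, word, h.rot_add, rot_single, mul_assoc]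

theorem Std.retwist (h : Std p ρ τ) (i : Fin 3) (n : ℤ) : Std p ρ (ρ i ^ n * τ) where
  comm := h.comm
  pow := h.pow
  sq := by
    have h1 := h.word_retwist i n 0 2
    rw [h.word_eq_one (by simp) (by decide), word, rot_zero, one_mul] at h1
    exact h1
  refl_mul := by
    intro j
    rw [mul_assoc, h.refl_mul, ← mul_assoc, ← mul_assoc,
      ((h.comm i j).zpow_left n).inv_right.eq]
  trans := by
    intro y z
    obtain ⟨a, e, hz⟩ := h.trans y z
    refine ⟨a - Pi.single i (if Even e then 0 else n), e, ?_⟩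
    rw [h.word_retwist, add_sub_cancel, hz]
  free := by
    intro y a e hy
    rw [h.word_retwist] at hy
    obtain ⟨h1, h2⟩ := h.free _ _ _ hy
    rw [if_pos h2, Pi.single_zero, zero_add] at h1
    exact ⟨h1, h2⟩

namespace Config

variable (h : Config p G ρ τ σ τ₂)
include h

theorem zpow_class {i : Fin 3} (hi : i ≠ 2) (n : ℤ) (y : Ω) :
    orbits {ρ 0, ρ 1} ((ρ i ^ n) y) y := by
  rw [orbits_pair (h.std₁.comm 0 1)]
  fin_cases i
  · exact ⟨n, 0, by simp⟩
  · exact ⟨0, n, by simp⟩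
  · exact absurd rfl hi

theorem retwist {i : Fin 3} (hi : i ≠ 2) (n : ℤ) : Config p G ρ (ρ i ^ n * τ) σ τ₂ :=
  { h with
    std₁ := h.std₁.retwist i n
    mem_refl₁ := G.mul_mem (G.zpow_mem (h.mem_rot₁ i) n) h.mem_refl₁
    agree_refl := fun y => (orbits {ρ 0, ρ 1}).trans' (h.agree_refl y)
      ((orbits {ρ 0, ρ 1}).symm' (h.zpow_class hi n _)) }

/-- One matched reflection is enough for `matching`. Its defect along `ρ i` is absorbed into `τ`; if
no reflection moves `x` inside its class, nothing is to be matched. -/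
theorem exists_retwist (i : Fin 3) {A : Setoid Ω} {C : Ω → Ω → Prop} {x : Ω}
    (hA : ∀ a, C x (word σ τ₂ a 1 x) →
      ∃ n : ℤ, A (word σ τ₂ a 1 x) ((ρ i ^ n) (word ρ τ a 1 x))) :
    ∃ n : ℤ, ∀ a, C x (word σ τ₂ a 1 x) →
      ∃ b, C x (word σ τ₂ b 1 x) ∧ A (word ρ (ρ i ^ n * τ) b 1 x) (word σ τ₂ b 1 x) := by
  by_cases hex : ∃ b, C x (word σ τ₂ b 1 x)
  · obtain ⟨b, hb⟩ := hex
    obtain ⟨n, hn⟩ := hA b hb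
    refine ⟨n, fun a _ => ⟨b, hb, ?_⟩⟩
    rw [h.std₁.word_retwist, if_neg (by decide), h.std₁.word_single_add]
    exact A.symm hn
  · exact ⟨0, fun a ha => absurd ⟨a, ha⟩ hex⟩

/-- For `spread`, let `k = r⁻¹ * s` with `r, s` agreeing at `x`. By block-regularity `k` fixes all
classes of the second partition. As `r` and `s` have the same parity, `k` commutes with `ρ i` on the
coupling class of `x`; fixing the `A`-class of `x`, it then fixes that of every coupled point. -/
theorem matching_level {A : Setoid Ω} {i : Fin 3}
    (hL : Level G A (orbits {ρ 0, ρ 1}) (p i) (ρ i))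
    (hpow : ActsAsPower A (orbits {ρ 0, ρ 1}) (p i) (ρ i) (σ i)) {x : Ω}
    (hx : A (σ i x) (ρ i x)) : Matching G ρ τ σ τ₂ A hL.Coupled x where
  refl := fun y => Level.Coupled.refl y
  symm := fun y z hyz => hyz.symm
  trans := fun y z w hyz hzw => hyz.trans hzw
  apply := fun g hg y z hyz => hL.coupled_apply hyz hg
  inv := hL.invA
  spread := by
    intro a e b f hC hA y hy
    have hpar := (h.even_of_agree (hL.le _ _ hA)).2
    have hr := h.word_mem₁ b f
    have hs := h.word_mem₂ a e
    have hk := G.mul_mem (G.inv_mem hr) hs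
    have hcomm := hL.comm_of_coupled (h.mem_rot₂ i) hpow hs hr (h.std₂.word_mul_gen a e i)
      (by rw [← neg_one_pow_eq hpar]; exact h.std₁.word_mul_gen b f i) hx hC hy
    have hkx : A (((word ρ τ b f)⁻¹ * word σ τ₂ a e) x) x := by
      have := hL.invA _ (G.inv_mem hr) _ _ (A.symm hA)
      rwa [perm_inv_apply] at this
    have hky := hL.fixes_of_coupled hk (h.reg _ hk x (hL.le _ _ hkx)) hy hkx hcomm
    have := hL.invA _ hr _ _ hky
    rw [Equiv.Perm.mul_apply, perm_apply_inv] at this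
    exact A.symm this

/-- Matching on the coupling classes of the first level, if these are contained in the coupling
classes of the second level. -/
theorem matching_level₁ {x : Ω} (hx₀ : σ 0 x = ρ 0 x) (hx₁ : orbits {ρ 0} (σ 1 x) (ρ 1 x))
    (ht : Torsion G (orbits {ρ 0}) (orbits {ρ 0, ρ 1}) (ρ 1) (p 0))
    (hC : ∀ y z, h.level₁.Coupled y z → h.level₂.Coupled y z) :
    Matching G ρ τ σ τ₂ ⊥ h.level₁.Coupled x where
  refl := fun y => Level.Coupled.refl y
  symm := fun y z hyz => hyz.symm
  trans := fun y z w hyz hzw => hyz.trans hzw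
  apply := fun g hg y z hyz => h.level₁.coupled_apply hyz hg
  inv := h.level₁.invA
  spread := by
    intro a e b f hCx hA y hy
    rw [Setoid.bot_def] at hA ⊢
    have hB₁ : orbits {ρ 0} (word ρ τ b f x) (word σ τ₂ a e x) := by
      rw [hA]
    have hpar := (h.even_of_agree (h.level₂.le _ _ hB₁)).2
    have hr := h.word_mem₁ b f
    have hs := h.word_mem₂ a e
    have hk := G.mul_mem (G.inv_mem hr) hs
    have hcomm := h.level₁.comm_of_coupled (h.mem_rot₂ 0) h.pow₁ hs hr (h.std₂.word_mul_gen a e 0)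
      (by rw [← neg_one_pow_eq hpar]; exact h.std₁.word_mul_gen b f 0) hx₀ hCx hy
    have hkx : ((word ρ τ b f)⁻¹ * word σ τ₂ a e) x = x := by
      rw [Equiv.Perm.mul_apply, ← hA, perm_inv_apply]
    have hky : orbits {ρ 0} (((word ρ τ b f)⁻¹ * word σ τ₂ a e) y) y := by
      have := (h.matching_level h.level₂ h.pow₂ hx₁).spread a e b f (hC _ _ hCx) hB₁ y (hC _ _ hy)
      have := h.inv₁ _ (G.inv_mem hr) _ _ ((orbits {ρ 0}).symm' this)
      rwa [perm_inv_apply] at this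
    set k := (word ρ τ b f)⁻¹ * word σ τ₂ a e with hkd
    have hkB := h.reg k hk x (by rw [hkx])
    -- `k` need not fix all `ρ 0`-orbits. The exponent `M` makes it a translation of the second
    -- level, `p 1` makes it fix the `ρ 0`-orbits, and `p 0 - 1` makes it a translation of the first
    -- level; all three are prime to `p 0`.
    obtain ⟨M, hM, hMT⟩ := h.level₂.exists_pow_mem_translations ht
    have hfix : ∀ u, orbits {ρ 0} (((k ^ M) ^ p 1) u) u :=
      h.level₂.translation_pow_prime (hMT k hk hkB)
    have hmem := h.level₁.pow_sub_one_mem_translations (G.pow_mem (G.pow_mem hk M) (p 1)) hfix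
    rw [← pow_mul, ← pow_mul, ← mul_assoc] at hmem
    have hn : ¬ p 0 ∣ M * p 1 * (p 0 - 1) := by
      rw [(h.prime 0).dvd_mul, (h.prime 0).dvd_mul]
      rintro ((hd | hd) | hd)
      · exact hM hd
      · exact h.inj.ne (show (0 : Fin 3) ≠ 1 by decide)
          ((Nat.prime_dvd_prime_iff_eq (h.prime 0) (h.prime 1)).1 hd)
      · have := (h.prime 0).two_le
        have := Nat.le_of_dvd (by omega) hd
        omega
    have := h.level₁.fixes_of_coupled_of_pow hk hn hmem hy (by rw [Setoid.bot_def]; exact hkx)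
      hky hcomm
    rw [Setoid.bot_def] at this
    rw [hkd, Equiv.Perm.mul_apply, Equiv.Perm.inv_eq_iff_eq] at this
    exact this.symm

theorem zpow_eq_one₂ (i : Fin 3) {n : ℤ} (hn : (p i : ℤ) ∣ n) : σ i ^ n = 1 := by
  obtain ⟨k, rfl⟩ := hn
  rw [zpow_mul, zpow_natCast, h.std₂.pow, one_zpow]

theorem zpow_eq_one₁ (i : Fin 3) {n : ℤ} (hn : (p i : ℤ) ∣ n) : ρ i ^ n = 1 := by
  obtain ⟨k, rfl⟩ := hn
  rw [zpow_mul, zpow_natCast, h.std₁.pow, one_zpow]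

theorem zpow_rel₁ {x : Ω} (hx₀ : σ 0 x = ρ 0 x) (n : ℤ) : (σ 0 ^ n) x = (ρ 0 ^ n) x := by
  have := h.level₁.zpow_base (h.mem_rot₂ 0) h.pow₁ (x := x) (by rw [Setoid.bot_def]; exact hx₀) n
  rwa [Setoid.bot_def] at this

theorem matched₂ {x : Ω} (hx₀ : σ 0 x = ρ 0 x) (hx₁ : orbits {ρ 0} (σ 1 x) (ρ 1 x))
    (hrefl : ∀ a, h.level₂.Coupled x (word σ τ₂ a 1 x) → ∃ b,
      h.level₂.Coupled x (word σ τ₂ b 1 x) ∧ orbits {ρ 0} (word ρ τ b 1 x) (word σ τ₂ b 1 x))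
    (a : Fin 3 → ℤ) (e : ℕ) (ha : h.level₂.Coupled x (word σ τ₂ a e x)) :
    orbits {ρ 0} (word ρ τ a e x) (word σ τ₂ a e x) := by
  refine h.matching (h.matching_level h.level₂ h.pow₂ hx₁) (fun n _ => ?_) (fun n _ => ?_) hrefl
    a e ha
  · rw [h.zpow_rel₁ hx₀]
  · exact (orbits {ρ 0}).symm' (h.level₂.zpow_base (h.mem_rot₂ 1) h.pow₂ hx₁ n)

theorem exists_retwist₂ {x : Ω} : ∃ n : ℤ, ∀ a, h.level₂.Coupled x (word σ τ₂ a 1 x) → ∃ b,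
      h.level₂.Coupled x (word σ τ₂ b 1 x) ∧
      orbits {ρ 0} (word ρ (ρ 1 ^ n * τ) b 1 x) (word σ τ₂ b 1 x) :=
  h.exists_retwist 1 (fun a _ => h.level₂.orbit _ _ (h.agree_word x a 1))

theorem retwist_rel₁ (n : ℤ) (a : Fin 3 → ℤ) (e : ℕ) (x : Ω) :
    orbits {ρ 0} (word ρ (ρ 0 ^ n * τ) a e x) (word ρ τ a e x) := by
  rw [h.std₁.word_retwist, h.std₁.word_single_add, orbits_singleton]
  exact ⟨_, rfl⟩

theorem retwist_word (i j : Fin 3) (m n : ℤ) (a : Fin 3 → ℤ) (e : ℕ) :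
    ∃ b f, word ρ (ρ i ^ m * (ρ j ^ n * τ)) a e = word ρ τ b f := by
  rw [(h.std₁.retwist j n).word_retwist, h.std₁.word_retwist]
  exact ⟨_, _, rfl⟩

theorem exists_conj_of_coupled_le {x : Ω} (hx₀ : σ 0 x = ρ 0 x)
    (hx₁ : orbits {ρ 0} (σ 1 x) (ρ 1 x))
    (ht : Torsion G (orbits {ρ 0}) (orbits {ρ 0, ρ 1}) (ρ 1) (p 0))
    (hI : ∀ y z, h.level₁.Coupled y z → orbits {ρ 0, ρ 1} y z → orbits {ρ 0} y z) :
    ∃ β ∈ twoClosure G, ∀ a e, ∃ b f, β * word σ τ₂ a e * β⁻¹ = word ρ τ b f := by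
  have hC : ∀ y z, h.level₁.Coupled y z → h.level₂.Coupled y z := by
    intro y z hE
    -- A translation of the second level fixing the class of `y` and moving that of `z` to its
    -- neighbour would couple `z` with `ρ 1 z` on the first level, against `hI`.
    by_contra hc
    obtain ⟨t, htT, hty, htz⟩ := h.level₂.exists_translation_of_not_coupled hc (h.level₂.step z)
    have h1 : h.level₁.Coupled z (ρ 1 z) :=
      hE.symm.trans ((h.level₁.coupled_of_rel hty).symm.trans
        ((h.level₁.coupled_apply hE htT.1).trans (h.level₁.coupled_of_rel htz)))
    have h2 := hI _ _ h1 ((orbits _).symm' (h.level₂.step z))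
    have h3 := (h.level₂.free 1 z).1 (by rw [zpow_one]; exact (orbits _).symm' h2)
    exact (h.prime 1).one_lt.ne' (by exact_mod_cast Int.natAbs_dvd_natAbs.2 h3 |> Nat.dvd_one.1)
  obtain ⟨n₁, hn₁⟩ := h.exists_retwist₂ (x := x)
  have h₁ := h.retwist (show (1 : Fin 3) ≠ 2 by decide) n₁
  have hgood := h₁.matched₂ hx₀ hx₁ hn₁
  obtain ⟨n₀, hn₀⟩ := h₁.exists_retwist (C := h.level₁.Coupled) (A := ⊥) (x := x) 0 (fun a ha => by
    obtain ⟨n, hn⟩ := orbits_singleton.1 (hgood a 1 (hC _ _ ha))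
    refine ⟨-n, ?_⟩
    rw [Setoid.bot_def, hn, ← Equiv.Perm.mul_apply, ← zpow_add, neg_add_cancel, zpow_zero]
    rfl)
  have h₂ := h₁.retwist (show (0 : Fin 3) ≠ 2 by decide) n₀
  set τ' := ρ 0 ^ n₀ * (ρ 1 ^ n₁ * τ) with hτ'
  have hgood₂ : ∀ a e, h.level₂.Coupled x (word σ τ₂ a e x) →
      orbits {ρ 0} (word ρ τ' a e x) (word σ τ₂ a e x) := fun a e ha =>
    (orbits {ρ 0}).trans' (h₁.retwist_rel₁ n₀ a e x) (hgood a e ha)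
  have hgood₁ : ∀ a e, h.level₁.Coupled x (word σ τ₂ a e x) →
      word ρ τ' a e x = word σ τ₂ a e x := by
    intro a e ha
    refine h₂.matching (h₂.matching_level₁ hx₀ hx₁ ht hC) (fun n _ => ?_) (fun n hn => ?_) hn₀
      a e ha
    · rw [h.zpow_rel₁ hx₀]
    · have h3 := h.level₂.zpow_base (h.mem_rot₂ 1) h.pow₂ hx₁ n
      have h4 : orbits {ρ 0, ρ 1} x ((σ 1 ^ n) x) :=
        (orbits _).symm' ((orbits _).trans' (h.level₂.le _ _ h3) (h.level₂.step_zpow n x))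
      have h5 := (h.level₂.free n x).1
        ((orbits {ρ 0}).symm' ((orbits {ρ 0}).trans' (hI _ _ hn h4) h3))
      rw [h.zpow_eq_one₁ 1 h5, h.zpow_eq_one₂ 1 h5]
  obtain ⟨β, hβ, hβw⟩ := exists_twoClosure_conj_word h₂.std₁ h₂.std₂ G h₂.mem_rot₁ h₂.mem_refl₁
    h₂.mem_rot₂ h₂.mem_refl₂ x (fun a e => by
      set z := word σ τ₂ a e x with hz
      set z' := word ρ τ' a e x with hz'
      have hzz' : orbits {ρ 0, ρ 1} z' z := (orbits _).symm' (h₂.agree_word x a e)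
      by_cases hc : h.level₂.Coupled x z
      · by_cases hE : h.level₁.Coupled x z
        · exact ⟨1, G.one_mem, rfl, (hgood₁ a e hE).symm⟩
        · obtain ⟨t, htT, h1, h2⟩ := h.level₁.exists_translation_of_not_coupled hE (hgood₂ a e hc)
          exact ⟨t, htT.1, h1, h2⟩
      · obtain ⟨t, htT, h1, h2⟩ := h.level₂.exists_translation_of_not_coupled hc hzz'
        obtain ⟨c, hc'⟩ := orbits_singleton.1 h1
        -- `t` fixes only the `ρ 0`-orbit of `x`; the power of `ρ 0` restores `x` itself without
        -- changing any `ρ 0`-orbit. The image of `z` stays uncoupled from `x` on the first level,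
        -- which permits the second move.
        have hc0 := G.zpow_mem (h.mem_rot₁ 0) (-c)
        have htG := G.mul_mem hc0 htT.1
        have hx : (ρ 0 ^ (-c) * t) x = x := by
          rw [Equiv.Perm.mul_apply, hc', ← Equiv.Perm.mul_apply, ← zpow_add, neg_add_cancel,
            zpow_zero]
          rfl
        have hE : ¬ h.level₁.Coupled x ((ρ 0 ^ (-c) * t) z) := by
          intro hE
          have := h.level₁.coupled_apply hE (G.inv_mem htG)
          rw [perm_inv_apply, Equiv.Perm.inv_eq_iff_eq.2 hx.symm] at this
          exact hc (hC _ _ this)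
        have hz1 : orbits {ρ 0} z' ((ρ 0 ^ (-c) * t) z) :=
          (orbits {ρ 0}).symm' ((orbits {ρ 0}).trans' (h.level₁.step_zpow (-c) (t z)) h2)
        obtain ⟨n, hnT, h3, h4⟩ := h.level₁.exists_translation_of_not_coupled hE hz1
        refine ⟨n * (ρ 0 ^ (-c) * t), G.mul_mem hnT.1 htG, ?_, ?_⟩
        · rw [Equiv.Perm.mul_apply, hx]; exact h3
        · exact h4)
  refine ⟨β, hβ, fun a e => ?_⟩
  rw [hβw]
  exact h.retwist_word _ _ _ _ _ _

end Config

end Cases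

/-! ### The second case: invariant `ρ 1`-orbits; assembly of both cases. -/

namespace Config

variable {Ω : Type*} {G : Subgroup (Perm Ω)} {p : Fin 3 → ℕ} {ρ σ : Fin 3 → Perm Ω}
  {τ τ₂ : Perm Ω} (h : Config p G ρ τ σ τ₂)
include h

theorem eq_of_orbits {y z : Ω} (h0 : orbits {ρ 0} y z) (h1 : orbits {ρ 1} y z) : y = z := by
  obtain ⟨a, ha⟩ := orbits_singleton.1 h0
  obtain ⟨b, hb⟩ := orbits_singleton.1 h1
  have h2 : (ρ 0 ^ a) z = (ρ 1 ^ b) z := ha.symm.trans hb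
  rw [← word_rot ρ τ, ← word_rot ρ τ, h.std₁.word_apply_eq_iff] at h2
  have h3 := h2.1 0
  have h4 : (p 0 : ℤ) ∣ a := by simpa using h3
  rw [ha, h.zpow_eq_one₁ 0 h4]
  rfl

section InvariantOrbits

variable (hinv : ∀ g ∈ G, ∀ y z, orbits {ρ 1} y z → orbits {ρ 1} (g y) (g z))
include hinv

/-- Within a class of the second partition the `ρ 0`-orbit of `y` meets every `ρ 1`-orbit.
Identities on a `ρ 0`-orbit thus extend to the whole class modulo `ρ 1`-orbits, which turns the
first level into a level over the `ρ 1`-orbits. -/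
theorem rel_of_eq_on_class {s s' : Perm Ω} (hs : s ∈ G) (hs' : s' ∈ G) {y : Ω}
    (hy : ∀ z, orbits {ρ 0} z y → s z = s' z) (z : Ω) (hz : orbits {ρ 0, ρ 1} z y) :
    orbits {ρ 1} (s z) (s' z) := by
  obtain ⟨a, b, rfl⟩ := (orbits_pair (h.std₁.comm 0 1)).1 hz
  rw [((h.std₁.comm 0 1).zpow_zpow a b).eq, Equiv.Perm.mul_apply]
  have h1 : orbits {ρ 1} ((ρ 1 ^ b) ((ρ 0 ^ a) y)) ((ρ 0 ^ a) y) := orbits_singleton.2 ⟨b, rfl⟩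
  have h2 := hinv s hs _ _ h1
  rw [hy _ (orbits_singleton.2 ⟨a, rfl⟩)] at h2
  exact (orbits {ρ 1}).trans' h2 ((orbits {ρ 1}).symm' (hinv s' hs' _ _ h1))

theorem level_of_invariant : Level G (orbits {ρ 1}) (orbits {ρ 0, ρ 1}) (p 0) (ρ 0) :=
  { h.preLevel₂ (i := 1) (j := 0) (by decide) hinv with
    norm := by
      intro g hg y
      obtain ⟨m, hm⟩ := h.norm₁ g hg y
      refine ⟨m, h.rel_of_eq_on_class hinv (G.mul_mem hg (h.mem_rot₁ 0))
        (G.mul_mem (G.zpow_mem (h.mem_rot₁ 0) m) hg) fun z hz => ?_⟩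
      have := hm z hz
      rwa [Setoid.bot_def] at this }

theorem pow_of_invariant :
    ActsAsPower (orbits {ρ 1}) (orbits {ρ 0, ρ 1}) (p 0) (ρ 0) (σ 0) := by
  intro y
  obtain ⟨j, hj0, hj⟩ := h.pow₁ y
  refine ⟨j, hj0, h.rel_of_eq_on_class hinv (h.mem_rot₂ 0) (G.zpow_mem (h.mem_rot₁ 0) j)
    fun z hz => ?_⟩
  have := hj z hz
  rwa [Setoid.bot_def] at this

/-- `σ 1` commutes with `σ 0`, hence acts as a translation on the `ρ 1`-orbits of each class. The
shift is killed by `p 1` modulo `p 0`, so it vanishes. -/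
theorem rot_one_of_invariant (y : Ω) : orbits {ρ 1} (σ 1 y) y := by
  have hL := h.level_of_invariant hinv
  have hpow := h.pow_of_invariant hinv
  have hB : ∀ y, orbits {ρ 0, ρ 1} (σ 1 y) y := fun y =>
    (h.level₂.actsAsPower_mem_translations (h.mem_rot₂ 1) h.pow₂).2 y |>.1
  have hT : σ 1 ∈ hL.translations := ⟨h.mem_rot₂ 1, fun y =>
    ⟨hB y, hL.comm_of_commute hpow (h.mem_rot₂ 1) (h.std₂.comm 1 0) (hB y)⟩⟩
  obtain ⟨a, ha⟩ := hL.orbit _ _ (hB y)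
  have h1 := hL.translation_pow hT ha (p 1)
  rw [h.std₂.pow] at h1
  have h2 := (hL.free _ _).1 ((orbits {ρ 1}).symm' h1)
  rcases Int.Prime.dvd_mul' (h.prime 0) h2 with h3 | h3
  · exact (orbits {ρ 1}).trans' ha ((hL.free _ _).2 h3)
  · rw [Int.natCast_dvd_natCast] at h3
    exact absurd ((Nat.prime_dvd_prime_iff_eq (h.prime 0) (h.prime 1)).1 h3)
      (h.inj.ne (by decide))

theorem exists_conj_of_invariant {x : Ω} (hx₀ : σ 0 x = ρ 0 x)
    (hx₁ : orbits {ρ 0} (σ 1 x) (ρ 1 x))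
    (ht : Torsion G (orbits {ρ 0}) (orbits {ρ 0, ρ 1}) (ρ 1) (p 0))
    (ht' : Torsion G (orbits {ρ 1}) (orbits {ρ 0, ρ 1}) (ρ 0) (p 1)) :
    ∃ β ∈ twoClosure G, ∀ a e, ∃ b f, β * word σ τ₂ a e * β⁻¹ = word ρ τ b f := by
  have hL := h.level_of_invariant hinv
  have hpow := h.pow_of_invariant hinv
  have hx₀' : orbits {ρ 1} (σ 0 x) (ρ 0 x) := by rw [hx₀]
  obtain ⟨n₁, hn₁⟩ := h.exists_retwist₂ (x := x)
  have h₁ := h.retwist (show (1 : Fin 3) ≠ 2 by decide) n₁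
  have hgood := h₁.matched₂ hx₀ hx₁ hn₁
  obtain ⟨n₀, hn₀⟩ := h₁.exists_retwist (C := hL.Coupled) (A := orbits {ρ 1}) (x := x) 0
    (fun a _ => hL.orbit _ _ (h₁.agree_word x a 1))
  have h₂ := h₁.retwist (show (0 : Fin 3) ≠ 2 by decide) n₀
  set τ' := ρ 0 ^ n₀ * (ρ 1 ^ n₁ * τ) with hτ'
  have hgood₂ : ∀ a e, h.level₂.Coupled x (word σ τ₂ a e x) →
      orbits {ρ 0} (word ρ τ' a e x) (word σ τ₂ a e x) := fun a e ha =>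
    (orbits {ρ 0}).trans' (h₁.retwist_rel₁ n₀ a e x) (hgood a e ha)
  have hρ1 : ∀ (n : ℤ) y, orbits {ρ 1} ((ρ 1 ^ n) y) y := fun n y => orbits_singleton.2 ⟨n, rfl⟩
  have hσ1 : ∀ (n : ℤ) y, orbits {ρ 1} ((σ 1 ^ n) y) y := by
    intro n y
    have hmem : σ 1 ∈ h.level₂.translations :=
      h.level₂.actsAsPower_mem_translations (h.mem_rot₂ 1) h.pow₂
    have hs : ∀ z, orbits {ρ 1} (σ 1 z) ((ρ 0 ^ (0 : ℤ)) z) := fun z => by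
      simpa using h.rot_one_of_invariant hinv z
    have := hL.actsAsPower_zpow (h.mem_rot₂ 1) (y := y) (j := 0) (fun z _ => hs z) n y
      ((orbits _).refl' _)
    simpa using this
  have hgood₁ : ∀ a e, hL.Coupled x (word σ τ₂ a e x) →
      orbits {ρ 1} (word ρ τ' a e x) (word σ τ₂ a e x) := fun a e ha =>
    h₂.matching (h₂.matching_level hL hpow hx₀')
      (fun n _ => (orbits {ρ 1}).symm' (hL.zpow_base (h.mem_rot₂ 0) hpow hx₀' n))
      (fun n _ => (orbits {ρ 1}).trans' (hρ1 n x) ((orbits {ρ 1}).symm' (hσ1 n x))) hn₀ a e ha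
  obtain ⟨β, hβ, hβw⟩ := exists_twoClosure_conj_word h₂.std₁ h₂.std₂ G h₂.mem_rot₁ h₂.mem_refl₁
    h₂.mem_rot₂ h₂.mem_refl₂ x (fun a e => by
      set z := word σ τ₂ a e x with hz
      -- The target differs from `z` by `ρ 0 ^ c * ρ 1 ^ d`. Each factor is realized separately: it
      -- is trivial if the point is coupled to `x` on the relevant level, and is given by
      -- `exists_move` otherwise.
      obtain ⟨c, d, hz'⟩ := (orbits_pair (h.std₁.comm 0 1)).1
        ((orbits _).symm' (h₂.agree_word x a e))
      rw [← hz, Equiv.Perm.mul_apply] at hz'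
      rw [hz']
      obtain ⟨t, htG, htx, htz⟩ : ∃ t ∈ G, t x = x ∧ t z = (ρ 1 ^ d) z := by
        by_cases hc : h.level₂.Coupled x z
        · have h1 := hgood₂ a e hc
          rw [hz', ← hz] at h1
          have h2 := (orbits {ρ 0}).trans' ((orbits {ρ 0}).symm' (h.level₁.step_zpow c _)) h1
          rw [h.zpow_eq_one₁ 1 ((h.level₂.free _ _).1 h2)]
          exact ⟨1, G.one_mem, rfl, rfl⟩
        · exact h.level₂.exists_move hL (fun y z => h.eq_of_orbits)
            (fun y => by simpa using hρ1 1 y) ht' (h.inj.ne (by decide)) hc d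
      set w := (ρ 1 ^ d) z with hw
      obtain ⟨t', htG', htx', htz'⟩ : ∃ t ∈ G, t x = x ∧ t w = (ρ 0 ^ c) w := by
        by_cases hc : hL.Coupled x w
        · have h1 := hgood₁ a e (hc.trans (hL.coupled_of_rel (hL.le _ _ (hρ1 d z))))
          rw [hz', ← hz] at h1
          have h2 := (orbits {ρ 1}).trans' h1 ((orbits {ρ 1}).symm' (hρ1 d z))
          rw [h.zpow_eq_one₁ 0 ((hL.free _ _).1 h2)]
          exact ⟨1, G.one_mem, rfl, rfl⟩
        · exact hL.exists_move h.level₂ (fun y z h1 h0 => h.eq_of_orbits h0 h1)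
            (fun y => h.level₁.step y) ht (h.inj.ne (by decide)) hc c
      refine ⟨t' * t, G.mul_mem htG' htG, ?_, ?_⟩
      · rw [Equiv.Perm.mul_apply, htx, htx']
      · rw [Equiv.Perm.mul_apply, htz, htz'])
  refine ⟨β, hβ, fun a e => ?_⟩
  rw [hβw]
  exact h.retwist_word _ _ _ _ _ _

end InvariantOrbits

/-- If two points of a class of the second partition are coupled on the first level without being
in the same class of the first partition, then the orbits of `ρ 1` are permuted by `G`. -/
theorem invariant_of_coupled {y₀ z₀ : Ω} (hE : h.level₁.Coupled y₀ z₀)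
    (hB : orbits {ρ 0, ρ 1} y₀ z₀) (hA : ¬ orbits {ρ 0} y₀ z₀) :
    ∀ g ∈ G, ∀ y z, orbits {ρ 1} y z → orbits {ρ 1} (g y) (g z) := by
  have hL₁ := h.level₁
  have hL₂ := h.level₂
  -- The single coupled pair is carried to every point by transitivity, and an exponent prime to `p
  -- 1` generates all the others.
  have hcoup : ∀ u (c : ℤ), h.level₁.Coupled u ((ρ 1 ^ c) u) := by
    intro u c
    obtain ⟨b, hb⟩ := hL₂.orbit _ _ hB
    have hb0 : ¬ (p 1 : ℤ) ∣ b := fun hd =>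
      hA ((orbits {ρ 0}).trans' hb ((hL₂.free _ _).2 hd))
    have h1 : h.level₁.Coupled z₀ ((ρ 1 ^ b) z₀) := hE.symm.trans (hL₁.coupled_of_rel hb)
    obtain ⟨a, e, rfl⟩ := h.std₁.trans z₀ u
    set g := word ρ τ a e with hg
    have hgG : g ∈ G := h.word_mem₁ a e
    obtain ⟨m, hm⟩ := h.norm₂ g hgG z₀
    have hm0 := hL₂.not_dvd_of_normalizes hgG (hm z₀ ((orbits _).refl' _))
    have h2 : h.level₁.Coupled (g z₀) ((ρ 1 ^ (m * b)) (g z₀)) :=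
      (hL₁.coupled_apply h1 hgG).trans
        (hL₁.coupled_of_rel (hL₂.normalizes_zpow hm b z₀ ((orbits _).refl' _)))
    have hmb : ¬ (p 1 : ℤ) ∣ m * b := fun hd => by
      rcases Int.Prime.dvd_mul' (h.prime 1) hd with hd | hd
      · exact hm0 hd
      · exact hb0 hd
    obtain ⟨n, hn⟩ := hL₂.exists_inv_mod hmb
    have h3 := h.level₁.coupled_zpow (G.zpow_mem (h.mem_rot₁ 1) (m * b)) h2 (n * c)
    rw [← zpow_mul] at h3
    refine h3.trans (hL₁.coupled_of_rel (hL₂.zpow_congr.2 ?_))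
    rw [show m * b * (n * c) - c = (m * b * n - 1) * c by ring]
    exact hn.mul_right _
  have hcomm : ∀ t ∈ h.level₁.translations, t * ρ 1 = ρ 1 * t := by
    intro t ht
    ext u
    obtain ⟨j, hj⟩ := hL₁.orbit _ _ (ht.2 u).1
    have h1 := h.level₁.translation_eq_zpow ht (hcoup u 1) hj
    rw [Setoid.bot_def] at hj h1
    rw [zpow_one] at h1
    rw [Equiv.Perm.mul_apply, Equiv.Perm.mul_apply, h1, hj, ← Equiv.Perm.mul_apply,
      ← Equiv.Perm.mul_apply, ((h.std₁.comm 0 1).zpow_left j).eq]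
  have hconj : ∀ g ∈ G, ∀ y, orbits {ρ 1} ((g * ρ 1 * g⁻¹) y) y := by
    intro g hg y
    set u := g * ρ 1 * g⁻¹ with hu
    have huG : u ∈ G := G.mul_mem (G.mul_mem hg (h.mem_rot₁ 1)) (G.inv_mem hg)
    have huT : u ∈ h.level₂.translations :=
      h.level₂.conj_mem_translations h.level₂.mem_translations hg
    -- `g⁻¹ * ρ 0 * g` is a translation of the first level, and these commute with `ρ 1` by `hcomm`.
    have hu0 : u * ρ 0 = ρ 0 * u := by
      have h1 := h.level₁.conj_mem_translations h.level₁.mem_translations (G.inv_mem hg)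
      rw [inv_inv] at h1
      have h2 := hcomm _ h1
      calc u * ρ 0 = g * (ρ 1 * (g⁻¹ * ρ 0 * g)) * g⁻¹ := by rw [hu]; group
        _ = g * (g⁻¹ * ρ 0 * g * ρ 1) * g⁻¹ := by rw [h2]
        _ = ρ 0 * u := by rw [hu]; group
    set n := u * ρ 1 * u⁻¹ * (ρ 1)⁻¹ with hn
    have hnG : n ∈ G := G.mul_mem (G.mul_mem (G.mul_mem huG (h.mem_rot₁ 1)) (G.inv_mem huG))
      (G.inv_mem (h.mem_rot₁ 1))
    have hn0 : Commute n (ρ 0) := by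
      have c1 : Commute u (ρ 0) := hu0
      have c2 : Commute (ρ 1) (ρ 0) := h.std₁.comm 1 0
      exact ((c1.mul_left c2).mul_left c1.inv_left).mul_left c2.inv_left
    have hnT : n ∈ h.level₁.translations := by
      refine ⟨hnG, fun w => ⟨?_, ?_⟩⟩
      · have := (huT.2 (u⁻¹ ((ρ 1)⁻¹ w))).2
        rw [perm_apply_inv, perm_apply_inv] at this
        exact this
      · rw [Setoid.bot_def, ← Equiv.Perm.mul_apply, ← Equiv.Perm.mul_apply, hn0.eq]
    -- The commutator `n` is a translation of the first level, so its order divides `p 0`. It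
    -- commutes with `ρ 1`, and `n * ρ 1` is conjugate to `ρ 1`, so its order also divides `p 1`.
    have hn1 : n = 1 := by
      have e0 : n ^ p 0 = 1 := by
        ext w
        have := h.level₁.translation_pow_prime hnT w
        rw [Setoid.bot_def] at this
        rw [this]; rfl
      have e1 : n ^ p 1 = 1 := by
        have c1 : Commute n (ρ 1) := hcomm n hnT
        have c2 : (n * ρ 1) ^ p 1 = n ^ p 1 := by rw [c1.mul_pow, h.std₁.pow, mul_one]
        rw [← c2, hn, inv_mul_cancel_right, conj_pow, h.std₁.pow, mul_one, mul_inv_cancel]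
      have hd := Nat.dvd_gcd (orderOf_dvd_of_pow_eq_one e0) (orderOf_dvd_of_pow_eq_one e1)
      rw [((Nat.coprime_primes (h.prime 0) (h.prime 1)).2 (h.inj.ne (by decide))).gcd_eq_one]
        at hd
      exact orderOf_eq_one_iff.1 (Nat.dvd_one.1 hd)
    have hu1 : Commute u (ρ 1) := by
      have : u * ρ 1 = n * ρ 1 * u := by rw [hn]; group
      rw [hn1, one_mul] at this
      exact this
    -- `u` agrees at `y` with `ρ 0 ^ a * ρ 1 ^ b`, and so do all powers, since the two commute. From
    -- `u ^ p 1 = 1` it follows that `p 0` divides `a`.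
    obtain ⟨a, b, hab⟩ := (orbits_pair (h.std₁.comm 0 1)).1 (huT.2 y).1
    set v := ρ 0 ^ a * ρ 1 ^ b with hv
    have huv : Commute u v := ((show Commute u (ρ 0) from hu0).zpow_right a).mul_right
      (hu1.zpow_right b)
    have hk : ∀ k : ℕ, (u ^ k) y = (v ^ k) y := by
      intro k
      induction k with
      | zero => rfl
      | succ k ih =>
        rw [pow_succ', Equiv.Perm.mul_apply, ih, ← Equiv.Perm.mul_apply, (huv.pow_right k).eq,
          Equiv.Perm.mul_apply, hab, pow_succ]
        rfl
    have h1 := hk (p 1)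
    have h2 : u ^ p 1 = 1 := by rw [hu, conj_pow, h.std₁.pow, mul_one, mul_inv_cancel]
    rw [h2] at h1
    have h3 : v = word ρ τ ![a, b, 0] 0 := by simp [word, rot, hv]
    have h4 : v ^ p 1 = word ρ τ ((p 1 : ℤ) • ![a, b, 0]) 0 := by
      rw [h3, word, word, pow_zero, mul_one, mul_one, h.std₁.rot_zsmul, zpow_natCast]
    rw [h4] at h1
    have h5 := (h.std₁.free y _ _ h1.symm).1 0
    have h6 : (p 0 : ℤ) ∣ p 1 * a := by simpa using h5
    have h7 : (p 0 : ℤ) ∣ a := (h.isCoprime (show (0 : Fin 3) ≠ 1 by decide)).dvd_of_dvd_mul_left h6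
    rw [hab, hv, h.zpow_eq_one₁ 0 h7, one_mul]
    exact orbits_singleton.2 ⟨b, rfl⟩
  intro g hg y z hyz
  obtain ⟨a, rfl⟩ := orbits_singleton.1 hyz
  have h1 : ∀ (n : ℤ) w, orbits {ρ 1} (((g * ρ 1 * g⁻¹) ^ n) w) w := by
    intro n w
    induction n using Int.induction_on with
    | zero => exact (orbits _).refl' _
    | succ n ih =>
      rw [add_comm, zpow_add, zpow_one]
      exact (orbits {ρ 1}).trans' (hconj g hg _) ih
    | pred n ih =>
      rw [sub_eq_neg_add, zpow_add, zpow_neg_one, Equiv.Perm.mul_apply]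
      refine (orbits {ρ 1}).trans' ((orbits {ρ 1}).symm' ?_) ih
      have := hconj g hg ((g * ρ 1 * g⁻¹)⁻¹ (((g * ρ 1 * g⁻¹) ^ (-n : ℤ)) w))
      rwa [perm_apply_inv] at this
  have h2 := h1 a (g z)
  rw [conj_zpow, Equiv.Perm.mul_apply, perm_inv_apply] at h2
  exact h2

/-- Replacing the generators of the second group by powers one can make them agree with those of
the first group at `x`. -/
theorem exists_normalized (x : Ω) : ∃ σ', Config p G ρ τ σ' τ₂ ∧ σ' 0 x = ρ 0 x ∧
    orbits {ρ 0} (σ' 1 x) (ρ 1 x) ∧ ∀ a e, ∃ b, word σ τ₂ a e = word σ' τ₂ b e := by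
  have hL₁ := h.level₁
  have hL₂ := h.level₂
  have hpow : ∀ {A B : Setoid Ω} {i : Fin 3} (_ : Level G A B (p i) (ρ i))
      (_ : ActsAsPower A B (p i) (ρ i) (σ i)), ∃ k l : ℤ, (p i : ℤ) ∣ k * l - 1 ∧
      A ((σ i ^ k) x) (ρ i x) ∧ ActsAsPower A B (p i) (ρ i) (σ i ^ k) := by
    intro A B i hL hp
    obtain ⟨j, hj0, hj⟩ := hp x
    obtain ⟨k, hk⟩ := hL.exists_inv_mod hj0
    have hk0 : ¬ (p i : ℤ) ∣ k := fun hd => by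
      have h1 := (dvd_sub_right (hd.mul_left j)).1 hk
      exact (h.prime i).one_lt.ne' (by exact_mod_cast Int.natAbs_dvd_natAbs.2 h1 |> Nat.dvd_one.1)
    refine ⟨k, j, by rwa [mul_comm], ?_, fun y => ?_⟩
    · have h1 := hL.actsAsPower_zpow (h.mem_rot₂ i) hj k x (B.refl _)
      have h2 := (hL.zpow_congr (a := j * k) (b := 1) (y := x)).2 hk
      rw [zpow_one] at h2
      exact A.trans h1 h2
    · obtain ⟨m, hm0, hm⟩ := hp y
      refine ⟨m * k, fun hd => ?_, hL.actsAsPower_zpow (h.mem_rot₂ i) hm k⟩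
      rcases Int.Prime.dvd_mul' (h.prime i) hd with hd | hd
      · exact hm0 hd
      · exact hk0 hd
  obtain ⟨k₀, l₀, hkl₀, hx₀, hp₀⟩ := hpow hL₁ h.pow₁
  obtain ⟨k₁, l₁, hkl₁, hx₁, hp₁⟩ := hpow hL₂ h.pow₂
  rw [Setoid.bot_def] at hx₀
  set k : Fin 3 → ℤ := ![k₀, k₁, 1] with hk
  set l : Fin 3 → ℤ := ![l₀, l₁, 1] with hl
  have hkl : ∀ i, (p i : ℤ) ∣ k i * l i - 1 := by
    intro i
    fin_cases i
    · exact hkl₀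
    · exact hkl₁
    · simp [hk, hl]
  set σ' : Fin 3 → Perm Ω := fun i => σ i ^ k i with hσ'
  have hw : ∀ a e, word σ' τ₂ a e = word σ τ₂ (k * a) e := by
    intro a e
    simp only [word, rot, hσ', Pi.mul_apply, zpow_mul]
  have hw' : ∀ a e, word σ τ₂ a e = word σ' τ₂ (l * a) e := by
    intro a e
    rw [hw, ← mul_inv_eq_one, h.std₂.word_inv, h.std₂.word_mul]
    refine h.std₂.word_eq_one (fun i => ?_) ⟨e, rfl⟩
    have : (a + (-1 : ℤ) ^ e • -((-1 : ℤ) ^ e • (k * (l * a)))) i = -((k i * l i - 1) * a i) := by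
      have hs : (-1 : ℤ) ^ e * (-1) ^ e = 1 := by
        rw [← mul_pow]; simp
      simp only [Pi.add_apply, Pi.smul_apply, Pi.neg_apply, Pi.mul_apply, smul_eq_mul]
      linear_combination (-(k i * (l i * a i))) * hs
    rw [this, dvd_neg]
    exact (hkl i).mul_right _
  refine ⟨σ', ?_, hx₀, hx₁, fun a e => ⟨_, hw' a e⟩⟩
  have hσ'i : ∀ i, σ' i = σ i ^ k i := fun i => rfl
  exact
    { h with
      std₂ :=
        { comm := fun i j => (h.std₂.comm i j).zpow_zpow _ _
          pow := fun i => by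
            rw [hσ'i, ← zpow_natCast, ← zpow_mul, mul_comm, zpow_mul, zpow_natCast, h.std₂.pow,
              one_zpow]
          sq := h.std₂.sq
          refl_mul := fun i => by rw [hσ'i, h.std₂.refl_mul_zpow, zpow_neg]
          trans := fun y z => by
            obtain ⟨a, e, hz⟩ := h.std₂.trans y z
            exact ⟨l * a, e, by rw [← hw', hz]⟩
          free := fun y a e hy => by
            rw [hw] at hy
            obtain ⟨h1, h2⟩ := h.std₂.free _ _ _ hy
            refine ⟨fun i => ?_, h2⟩
            have h3 : (p i : ℤ) ∣ k i * a i := h1 i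
            have h4 : a i = k i * a i * l i - (k i * l i - 1) * a i := by ring
            rw [h4]
            exact dvd_sub (h3.mul_right _) ((hkl i).mul_right _) }
      mem_rot₂ := fun i => G.zpow_mem (h.mem_rot₂ i) _
      pow₁ := hp₀
      pow₂ := hp₁
      agree_rot := fun y => by
        have : σ' 2 = σ 2 := by rw [hσ'i]; simp [hk]
        rw [this]
        exact h.agree_rot y }

theorem exists_torsion [Finite Ω] {A : Setoid Ω} {i : Fin 3}
    (hL : Level G A (orbits {ρ 0, ρ 1}) (p i) (ρ i))
    (hpow : ActsAsPower A (orbits {ρ 0, ρ 1}) (p i) (ρ i) (σ i)) {j : Fin 3} (hj : j ≠ 2) :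
    ∃ H ≤ G, ∃ γ ∈ G, Config p H ρ τ (fun i => γ * σ i * γ⁻¹) (γ * τ₂ * γ⁻¹) ∧
      Torsion H A (orbits {ρ 0, ρ 1}) (ρ i) (p j) := by
  have hq2 : Nat.Coprime (p 2 * 2) (p j) :=
    Nat.Coprime.mul_left ((Nat.coprime_primes (h.prime 2) (h.prime j)).2 (h.inj.ne hj.symm))
      (Nat.coprime_two_left.2 (h.odd j))
  obtain ⟨γ, hγ, hγB, M, hM, hmult⟩ := h.exists_conj_mult_pow hL hpow (h.prime j) hq2
  have hsub : ∀ g ∈ Set.range ρ ∪ {τ} ∪ (Set.range (fun i => γ * σ i * γ⁻¹) ∪ {γ * τ₂ * γ⁻¹}),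
      g ∈ G := by
    rintro g ((⟨k, rfl⟩ | rfl) | (⟨k, rfl⟩ | rfl))
    · exact h.mem_rot₁ k
    · exact h.mem_refl₁
    · exact G.mul_mem (G.mul_mem hγ (h.mem_rot₂ k)) (G.inv_mem hγ)
    · exact G.mul_mem (G.mul_mem hγ h.mem_refl₂) (G.inv_mem hγ)
  set S := Set.range ρ ∪ {τ} ∪ (Set.range (fun i => γ * σ i * γ⁻¹) ∪ {γ * τ₂ * γ⁻¹}) with hS
  have hle : Subgroup.closure S ≤ G := (Subgroup.closure_le G).2 hsub
  refine ⟨Subgroup.closure S, hle, γ, hγ, h.conj hγ hγB hle ?_ ?_ ?_ ?_, M, hM, ?_⟩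
  · exact fun i => Subgroup.subset_closure (Or.inl (Or.inl ⟨i, rfl⟩))
  · exact Subgroup.subset_closure (Or.inl (Or.inr rfl))
  · exact fun i => Subgroup.subset_closure (Or.inr (Or.inl ⟨i, rfl⟩))
  · exact Subgroup.subset_closure (Or.inr (Or.inr rfl))
  · intro k hk hkB y
    exact ((hL.pow_mem_translations_of_mult (hle hk) hkB (hmult k hk)).2 y).2

/-- The two cases are separated by whether the `ρ 1`-orbits are invariant under the shrunken group.
Later conjugations only shrink the group further, so the torsion condition already obtained
persists. The generators are normalized at `x` last, because conjugation disturbs their agreement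
there. -/
theorem exists_twoClosure_conj [Finite Ω] (x : Ω) :
    ∃ β ∈ twoClosure G, ∀ a e, ∃ b f, β * word σ τ₂ a e * β⁻¹ = word ρ τ b f := by
  have hconj : ∀ {G H : Subgroup (Perm Ω)} {σ : Fin 3 → Perm Ω} {τ₂ γ : Perm Ω}, H ≤ G → γ ∈ G →
      (∃ β ∈ twoClosure H, ∀ a e, ∃ b f,
        β * word (fun i => γ * σ i * γ⁻¹) (γ * τ₂ * γ⁻¹) a e * β⁻¹ = word ρ τ b f) →
      ∃ β ∈ twoClosure G, ∀ a e, ∃ b f, β * word σ τ₂ a e * β⁻¹ = word ρ τ b f := by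
    rintro G H σ τ₂ γ hH hγ ⟨β, hβ, hw⟩
    refine ⟨β * γ, (twoClosure G).mul_mem (twoClosure_mono hH hβ) (le_twoClosure G hγ),
      fun a e => ?_⟩
    obtain ⟨b, f, hbf⟩ := hw a e
    refine ⟨b, f, ?_⟩
    rw [← hbf]
    simp only [word, rot, conj_zpow, conj_pow]
    group
  obtain ⟨H₁, hH₁, γ₁, hγ₁, h₁, ht₁⟩ :=
    h.exists_torsion h.level₂ h.pow₂ (show (0 : Fin 3) ≠ 2 by decide)
  refine hconj hH₁ hγ₁ ?_
  by_cases hinv : ∀ g ∈ H₁, ∀ y z, orbits {ρ 1} y z → orbits {ρ 1} (g y) (g z)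
  · obtain ⟨H₂, hH₂, γ₂, hγ₂, h₂, ht₂⟩ := h₁.exists_torsion (h₁.level_of_invariant hinv)
      (h₁.pow_of_invariant hinv) (show (1 : Fin 3) ≠ 2 by decide)
    refine hconj hH₂ hγ₂ ?_
    obtain ⟨σ', h₃, hx₀, hx₁, hw⟩ := h₂.exists_normalized x
    obtain ⟨β, hβ, hβw⟩ := h₃.exists_conj_of_invariant (fun g hg => hinv g (hH₂ hg)) hx₀ hx₁
      (ht₁.mono hH₂) ht₂
    refine ⟨β, hβ, fun a e => ?_⟩
    obtain ⟨b, hb⟩ := hw a e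
    rw [hb]
    exact hβw b e
  · obtain ⟨σ', h₃, hx₀, hx₁, hw⟩ := h₁.exists_normalized x
    obtain ⟨β, hβ, hβw⟩ := h₃.exists_conj_of_coupled_le hx₀ hx₁ ht₁ (fun y z hE hB => by
      by_contra hA
      exact hinv (h₃.invariant_of_coupled hE hB hA))
    refine ⟨β, hβ, fun a e => ?_⟩
    obtain ⟨b, hb⟩ := hw a e
    rw [hb]
    exact hβw b e

end Config

/-! ### From regular dihedral groups to normal forms. -/

section Generators

variable {Ω : Type*} {p : Fin 3 → ℕ} {ρ : Fin 3 → Perm Ω} {τ : Perm Ω}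

theorem Relations.exists_word (h : Relations p ρ τ) {g : Perm Ω} (hg : g ∈ dih ρ τ) :
    ∃ a e, g = word ρ τ a e := by
  induction hg using Subgroup.closure_induction with
  | mem g hg =>
    rcases hg with ⟨i, rfl⟩ | rfl
    · exact ⟨Pi.single i 1, 0, by simp [word, rot_single]⟩
    · exact ⟨0, 1, by simp [word, rot_zero]⟩
  | one => exact ⟨0, 0, by simp [word, rot_zero]⟩
  | mul g k _ _ hg hk =>
    obtain ⟨a, e, rfl⟩ := hg
    obtain ⟨b, f, rfl⟩ := hk
    exact ⟨_, _, h.word_mul a b e f⟩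
  | inv g _ hg =>
    obtain ⟨a, e, rfl⟩ := hg
    exact ⟨_, _, h.word_inv a e⟩

theorem Relations.exists_rot (h : Relations p ρ τ) {g : Perm Ω} (hg : g ∈ cyc ρ) :
    ∃ a, g = rot ρ a := by
  induction hg using Subgroup.closure_induction with
  | mem g hg =>
    obtain ⟨i, rfl⟩ := hg
    exact ⟨Pi.single i 1, by simp [rot_single]⟩
  | one => exact ⟨0, rot_zero.symm⟩
  | mul g k _ _ hg hk =>
    obtain ⟨a, rfl⟩ := hg
    obtain ⟨b, rfl⟩ := hk
    exact ⟨_, (h.rot_add a b).symm⟩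
  | inv g _ hg =>
    obtain ⟨a, rfl⟩ := hg
    exact ⟨_, (h.rot_neg a).symm⟩

theorem mem_dih_rot (i : Fin 3) : ρ i ∈ dih ρ τ := Subgroup.subset_closure (Or.inl ⟨i, rfl⟩)

theorem mem_dih_refl : τ ∈ dih ρ τ := Subgroup.subset_closure (Or.inr rfl)

theorem word_mem_dih (a : Fin 3 → ℤ) (e : ℕ) : word ρ τ a e ∈ dih ρ τ :=
  Std.word_mem _ mem_dih_rot mem_dih_refl a e

theorem Relations.zpow_eq_one_of_rot_eq_one (h : Relations p ρ τ) (hp : ∀ i, (p i).Prime)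
    (hinj : Function.Injective p) (hord : ∀ i, orderOf (ρ i) = p i) {a : Fin 3 → ℤ}
    (ha : rot ρ a = 1) (i : Fin 3) : (p i : ℤ) ∣ a i := by
  -- Raising to the product of the other primes isolates the factor `ρ i`.
  set N : ℤ := ∏ j ∈ Finset.univ.erase i, (p j : ℤ) with hN
  have h1 : rot ρ (Pi.single i (N * a i)) = 1 := by
    have h2 : Pi.single i (N * a i) = N • a + (Pi.single i (N * a i) - N • a) := by abel
    have h3 := h.word_eq_one (a := Pi.single i (N * a i) - N • a) (e := 0) (fun j => ?_) (by simp)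
    · rw [word, pow_zero, mul_one] at h3
      rw [h2, h.rot_add, h3, h.rot_zsmul, ha, one_zpow, one_mul]
    · rcases eq_or_ne j i with rfl | hj
      · simp
      · rw [Pi.sub_apply, Pi.single_eq_of_ne hj, zero_sub, dvd_neg, Pi.smul_apply, smul_eq_mul]
        exact (Finset.dvd_prod_of_mem _ (Finset.mem_erase.2 ⟨hj, Finset.mem_univ j⟩)).mul_right _
  rw [rot_single, ← orderOf_dvd_iff_zpow_eq_one, hord] at h1
  have hpi := Nat.prime_iff_prime_int.1 (hp i)
  refine (hpi.dvd_or_dvd h1).resolve_left fun hd => ?_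
  obtain ⟨j, hj, hd⟩ := (hpi.dvd_finsetProd_iff _).1 hd
  have := (Nat.prime_dvd_prime_iff_eq (hp i) (hp j)).1 (by exact_mod_cast hd)
  exact (Finset.ne_of_mem_erase hj) (hinj this).symm

theorem IsRegularDihedral.relations (h : IsRegularDihedral p ρ τ) : Relations p ρ τ where
  comm := fun i j => by
    have := h.cyclic
    have : IsMulCommutative (cyc ρ) := IsCyclic.isMulCommutative
    have hm : ∀ i, ρ i ∈ cyc ρ := fun i => Subgroup.subset_closure ⟨i, rfl⟩
    exact congrArg Subtype.val (this.is_comm.comm ⟨ρ i, hm i⟩ ⟨ρ j, hm j⟩)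
  pow := fun i => by rw [← h.orderOf_rot i, pow_orderOf_eq_one]
  sq := by rw [← h.orderOf_refl, pow_orderOf_eq_one]
  refl_mul := fun i => by
    have h1 := h.inverts (ρ i) (Subgroup.subset_closure ⟨i, rfl⟩)
    have h2 : τ⁻¹ = τ := by
      rw [inv_eq_iff_mul_eq_one, ← pow_two, ← h.orderOf_refl, pow_orderOf_eq_one]
    rw [← h1, h2, mul_assoc, mul_assoc, ← pow_two, ← h.orderOf_refl, pow_orderOf_eq_one, mul_one]

theorem IsRegularDihedral.std (h : IsRegularDihedral p ρ τ) (hp : ∀ i, (p i).Prime)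
    (hodd : ∀ i, Odd (p i)) (hinj : Function.Injective p) : Std p ρ τ where
  toRelations := h.relations
  trans := fun y z => by
    obtain ⟨g, ⟨hg, hgy⟩, -⟩ := h.regular y z
    obtain ⟨a, e, rfl⟩ := h.relations.exists_word hg
    exact ⟨a, e, hgy.symm⟩
  free := fun y a e hy => by
    have hr := h.relations
    have h1 : word ρ τ a e = 1 :=
      (h.regular y y).unique ⟨word_mem_dih a e, hy⟩ ⟨Subgroup.one_mem _, rfl⟩
    rcases Nat.even_or_odd' e with ⟨k, rfl | rfl⟩
    · rw [word, pow_mul, hr.sq, one_pow, mul_one] at h1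
      exact ⟨hr.zpow_eq_one_of_rot_eq_one hp hinj h.orderOf_rot h1, even_two_mul k⟩
    -- For odd `e` the reflection would be a rotation and would commute with `ρ 0`, which would then
    -- equal its own inverse although its order is odd.
    · rw [word, pow_succ, pow_mul, hr.sq, one_pow, one_mul] at h1
      have h2 : τ = rot ρ (-a) := by rw [hr.rot_neg, eq_inv_of_mul_eq_one_right h1]
      have h3 : τ * ρ 0 = ρ 0 * τ := by
        rw [h2, ← zpow_one (ρ 0), ← rot_single, hr.rot_comm]
      rw [hr.refl_mul, mul_left_inj, inv_eq_iff_mul_eq_one, ← pow_two, ← orderOf_dvd_iff_pow_eq_one,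
        h.orderOf_rot, Nat.prime_dvd_prime_iff_eq (hp 0) Nat.prime_two] at h3
      have := hodd 0
      rw [h3] at this
      exact absurd this (by decide)

end Generators

/-! ### Orbit partitions and invariance in terms of points. -/

section Partitions

variable {Ω : Type*} {G : Subgroup (Perm Ω)} {P : Setoid Ω}

theorem orbitPartition_zero {s : ℕ} (ρ : Fin s → Perm Ω) : orbitPartition ρ 0 = ⊥ := by
  ext y z
  have : ρ '' {j : Fin s | (j : ℕ) < 0} = ∅ := by simp
  change orbits (ρ '' {j : Fin s | (j : ℕ) < 0}) y z ↔ _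
  rw [this, orbits_iff, Subgroup.closure_empty, Setoid.bot_def]
  simp

theorem orbitPartition_one (ρ : Fin 3 → Perm Ω) : orbitPartition ρ 1 = orbits {ρ 0} := by
  have : ρ '' {j : Fin 3 | (j : ℕ) < 1} = {ρ 0} := by
    rw [← Set.image_singleton]
    congr 1
    ext j
    fin_cases j <;> simp
  rw [orbitPartition, this, orbits]

theorem orbitPartition_two (ρ : Fin 3 → Perm Ω) : orbitPartition ρ 2 = orbits {ρ 0, ρ 1} := by
  have : ρ '' {j : Fin 3 | (j : ℕ) < 2} = {ρ 0, ρ 1} := by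
    rw [← Set.image_pair]
    congr 1
    ext j
    fin_cases j <;> simp
  rw [orbitPartition, this, orbits]

theorem orbitPartition_self {s : ℕ} (ρ : Fin s → Perm Ω) :
    orbitPartition ρ s = orbits (Set.range ρ) := by
  have : ρ '' {j : Fin s | (j : ℕ) < s} = Set.range ρ := by
    rw [← Set.image_univ]
    congr 1
    ext j
    simp
  rw [orbitPartition, this, orbits]

theorem class_mem_classes (P : Setoid Ω) (z : Ω) : {w | P w z} ∈ P.classes := ⟨z, rfl⟩

theorem IsInvariant.apply (h : IsInvariant G P) {g : Perm Ω} (hg : g ∈ G) {y z : Ω} (hyz : P y z) :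
    P (g y) (g z) := by
  obtain ⟨u, hu⟩ := h g hg _ (class_mem_classes P z)
  have h1 : g y ∈ {w | P w u} := hu ▸ ⟨y, hyz, rfl⟩
  have h2 : g z ∈ {w | P w u} := hu ▸ ⟨z, P.refl z, rfl⟩
  exact P.trans h1 (P.symm h2)

theorem IsBlockRegular.apply (h : IsBlockRegular G P) (hP : IsInvariant G P) {g : Perm Ω}
    (hg : g ∈ G) {y : Ω} (hy : P (g y) y) (z : Ω) : P (g z) z := by
  have h1 : g '' {w | P w y} = {w | P w y} := by
    obtain ⟨u, hu⟩ := hP g hg _ (class_mem_classes P y)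
    have h2 : g y ∈ {w | P w u} := hu ▸ ⟨y, P.refl y, rfl⟩
    rw [hu]
    ext w
    exact ⟨fun hw => P.trans hw (P.trans (P.symm h2) hy),
      fun hw => P.trans hw (P.trans (P.symm hy) h2)⟩
  have h3 := h g hg _ (class_mem_classes P y) h1 _ (class_mem_classes P z)
  have h4 : g z ∈ {w | P w z} := h3 ▸ ⟨z, P.refl z, rfl⟩
  exact h4

end Partitions

/-! ### From the given setup to a configuration, and conclusion. -/

section Main

variable {Ω : Type*} {p : Fin 3 → ℕ} {ρ σ : Fin 3 → Perm Ω} {τ₁ τ₂ π : Perm Ω} {x : Ω}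

theorem Setup.actsAsPower (h : Setup p ρ σ τ₁ τ₂ π x) (i : Fin 3) :
    ActsAsPower (orbitPartition ρ i) (orbitPartition ρ (i + 1)) (p i) (ρ i) (σ i) := by
  intro y
  obtain ⟨j, hj1, hj2, hj⟩ := h.block_power i _ (class_mem_classes _ y)
  refine ⟨j, fun hd => ?_, fun z hz => by simpa using hj z hz⟩
  have := Nat.le_of_dvd hj1 (by exact_mod_cast hd)
  omega

theorem actsAsPower_self {A B : Setoid Ω} {ℓ : ℕ} (hℓ : ℓ.Prime) (ρ : Perm Ω) :
    ActsAsPower A B ℓ ρ ρ := fun _ =>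
  ⟨1, fun hd => hℓ.one_lt.ne' (Nat.dvd_one.1 (by exact_mod_cast hd)),
    fun z _ => by rw [zpow_one]⟩

/-- A group generated by two regular dihedral groups acts by affine maps on the classes on which
their rotations act as powers of each other. -/
theorem PreLevel.level_of_generators {G : Subgroup (Perm Ω)} {A B : Setoid Ω} {i : Fin 3}
    (h : PreLevel G A B (p i) (ρ i)) (h₁ : Relations p ρ τ₁) (h₂ : Relations p σ τ₂)
    (hG : G = dih ρ τ₁ ⊔ dih σ τ₂) (hpow : ActsAsPower A B (p i) (ρ i) (σ i)) :
    Level G A B (p i) (ρ i) := by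
  have hle₁ : dih ρ τ₁ ≤ G := hG ▸ le_sup_left
  have hle₂ : dih σ τ₂ ≤ G := hG ▸ le_sup_right
  refine h.normalizes_closure (hG.trans (Subgroup.closure_union _ _).symm) ?_
  have hself := actsAsPower_self (A := A) (B := B) h.prime (ρ i)
  rintro g ((⟨k, rfl⟩ | rfl) | (⟨k, rfl⟩ | rfl))
  · exact h.normalizes_of_semiconj h.mem hself (hle₁ (mem_dih_rot k)) (ε := 1)
      (by rw [zpow_one]; exact h₁.comm k i)
  · exact h.normalizes_of_semiconj h.mem hself (hle₁ mem_dih_refl) (ε := -1)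
      (by rw [zpow_neg_one]; exact h₁.refl_mul i)
  · exact h.normalizes_of_semiconj (hle₂ (mem_dih_rot i)) hpow (hle₂ (mem_dih_rot k)) (ε := 1)
      (by rw [zpow_one]; exact h₂.comm k i)
  · exact h.normalizes_of_semiconj (hle₂ (mem_dih_rot i)) hpow (hle₂ mem_dih_refl) (ε := -1)
      (by rw [zpow_neg_one]; exact h₂.refl_mul i)

/-- The second reflection maps `x` outside of its orbit under the rotations. -/
theorem Setup.exists_refl_apply (h : Setup p ρ σ τ₁ τ₂ π x) :
    ∃ n : ℤ, orbits {ρ 0, ρ 1} (τ₂ x) ((ρ 2 ^ n * τ₁) x) := by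
  have h₁ := h.dihedral₁.std h.prime h.odd h.distinct
  have h₂ := h.dihedral₂.std h.prime h.odd h.distinct
  obtain ⟨a, e, hae⟩ := h₁.trans x (τ₂ x)
  rcases Nat.even_or_odd e with he | he
  -- An even word would put `τ₂ x` in the orbit of `x` under the first rotation group. The second
  -- rotation group has the same orbits, against the freeness of the second dihedral group.
  · exfalso
    have h1 : word ρ τ₁ a e = rot ρ a := by
      obtain ⟨k, rfl⟩ := he
      rw [word, ← two_mul, pow_mul, h₁.sq, one_pow, mul_one]
    have h2 : orbits (Set.range ρ) (τ₂ x) x := by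
      refine orbits_iff.2 ⟨_, ?_, hae⟩
      have hm : ∀ i, ρ i ∈ Subgroup.closure (Set.range ρ) := fun i =>
        Subgroup.subset_closure ⟨i, rfl⟩
      rw [h1, ← mul_one (rot ρ a), ← pow_zero 1]
      exact Std.word_mem _ hm (Subgroup.one_mem _) a 0
    rw [← orbitPartition_self, h.same_orbits 3 le_rfl, orbitPartition_self, orbits_iff] at h2
    obtain ⟨g, hg, hgx⟩ := h2
    obtain ⟨b, rfl⟩ := h₂.exists_rot hg
    have h3 : word σ τ₂ 0 1 x = word σ τ₂ b 0 x := by simpa [word, rot_zero] using hgx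
    exact absurd ((h₂.word_apply_eq_iff x _ _ _ _).1 h3).2 (by decide)
  · refine ⟨a 2, ?_⟩
    have h1 : ρ 2 ^ a 2 * τ₁ = word ρ τ₁ (Pi.single 2 (a 2)) 1 := by
      rw [word, rot_single, pow_one]
    rw [hae, h1, h₁.orbits_word_iff]
    exact ⟨by simp, he.add_one⟩

/-- Multiplying `τ₁` by a power of `ρ 2` makes it agree with `τ₂` on the class of `x` in the second
partition. By block-regularity, agreement of two elements of `G` on one class is agreement on all
classes. -/
theorem Setup.config (h : Setup p ρ σ τ₁ τ₂ π x) {G : Subgroup (Perm Ω)}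
    (hG : G = dih ρ τ₁ ⊔ conj (dih ρ τ₁) π) (hreg : IsBlockRegular G (orbitPartition ρ 2)) :
    ∃ n : ℤ, Config p G ρ (ρ 2 ^ n * τ₁) σ τ₂ := by
  have h₁ := h.dihedral₁.std h.prime h.odd h.distinct
  have h₂ := h.dihedral₂.std h.prime h.odd h.distinct
  have hinv := h.invariant
  rw [← hG] at hinv
  rw [h.conj_dih] at hG
  have hle₁ : dih ρ τ₁ ≤ G := hG ▸ le_sup_left
  have hle₂ : dih σ τ₂ ≤ G := hG ▸ le_sup_right
  have hρ : ∀ i, ρ i ∈ G := fun i => hle₁ (mem_dih_rot i)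
  have hσ : ∀ i, σ i ∈ G := fun i => hle₂ (mem_dih_rot i)
  have inv₁ := hinv 1 (by decide)
  have inv₂ := hinv 2 (by decide)
  have pow₁ := h.actsAsPower 0
  have pow₂ := h.actsAsPower 1
  have base : orbits {ρ 0, ρ 1} (σ 2 x) (ρ 2 x) := by
    rw [← orbitPartition_two]
    exact h.base_point 2
  simp only [Fin.val_zero, Fin.val_one, zero_add, one_add_one_eq_two,
    orbitPartition_zero, orbitPartition_one, orbitPartition_two] at inv₁ inv₂ pow₁ pow₂
  rw [orbitPartition_two] at hreg
  have reg : ∀ g ∈ G, ∀ y, orbits {ρ 0, ρ 1} (g y) y → ∀ z, orbits {ρ 0, ρ 1} (g z) z :=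
    fun g hg y hy z => hreg.apply inv₂ hg hy z
  obtain ⟨n, hn⟩ := h.exists_refl_apply
  have hτ' : ρ 2 ^ n * τ₁ ∈ G := G.mul_mem (G.zpow_mem (hρ 2) n) (hle₁ mem_dih_refl)
  have agree : ∀ g ∈ G, ∀ k ∈ G, orbits {ρ 0, ρ 1} (g x) (k x) →
      ∀ y, orbits {ρ 0, ρ 1} (g y) (k y) := by
    intro g hg k hk hx y
    have h1 := inv₂.apply (G.inv_mem hk) hx
    rw [perm_inv_apply] at h1
    have h2 := inv₂.apply hk (reg (k⁻¹ * g) (G.mul_mem (G.inv_mem hk) hg) x h1 y)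
    rwa [Equiv.Perm.mul_apply, perm_apply_inv] at h2
  have hL₁ := h₁.preLevel₁ h.prime hρ (fun g hg y z => inv₁.apply hg)
  have hL₂ := h₁.preLevel₂ h.prime hρ (fun g hg y z => inv₂.apply hg) (i := 0) (j := 1) (by decide)
    (fun g hg y z => inv₁.apply hg)
  exact ⟨n,
    { prime := h.prime
      odd := h.odd
      inj := h.distinct
      std₁ := h₁.retwist 2 n
      std₂ := h₂
      mem_rot₁ := hρ
      mem_refl₁ := hτ'
      mem_rot₂ := hσ
      mem_refl₂ := hle₂ mem_dih_refl
      inv₁ := fun g hg y z => inv₁.apply hg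
      inv₂ := fun g hg y z => inv₂.apply hg
      reg := reg
      norm₁ := (hL₁.level_of_generators h₁.toRelations h₂.toRelations hG pow₁).norm
      norm₂ := (hL₂.level_of_generators h₁.toRelations h₂.toRelations hG pow₂).norm
      pow₁ := pow₁
      pow₂ := pow₂
      agree_rot := agree _ (hσ 2) _ (hρ 2) base
      agree_refl := agree _ (hle₂ mem_dih_refl) _ hτ' hn }⟩

/-- A regular group that is conjugated into another regular group is conjugated onto it. -/
theorem conj_eq_of_le {H K : Subgroup (Perm Ω)} (hH : IsRegular H) (hK : IsRegular K) {β : Perm Ω}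
    (x : Ω) (hle : ∀ g ∈ H, β * g * β⁻¹ ∈ K) : conj H β = K := by
  refine le_antisymm ?_ fun k hk => ?_
  · rintro _ ⟨g, hg, rfl⟩
    exact hle g hg
  · obtain ⟨g, ⟨hg, hgx⟩, -⟩ := hH x (β⁻¹ (k (β x)))
    refine ⟨g, hg, ?_⟩
    refine (hK (β x) (k (β x))).unique ⟨hle g hg, ?_⟩ ⟨hk, rfl⟩
    change β (g (β⁻¹ (β x))) = k (β x)
    rw [perm_inv_apply, hgx, perm_apply_inv]

end Main

end DihedralCI

theorem mainTheorem3 {Ω : Type*} [Finite Ω] (p : Fin 3 → ℕ) (ρ σ : Fin 3 → Equiv.Perm Ω)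
    (τ₁ τ₂ π : Equiv.Perm Ω) (x : Ω)
    (hsetup : DihedralCI.Setup p ρ σ τ₁ τ₂ π x)
    (G : Subgroup (Equiv.Perm Ω))
    (hG : G = DihedralCI.dih ρ τ₁ ⊔ DihedralCI.conj (DihedralCI.dih ρ τ₁) π)
    (hreg : DihedralCI.IsBlockRegular G (DihedralCI.orbitPartition ρ 2)) :
    ∃ β ∈ DihedralCI.twoClosure G,
      DihedralCI.conj (DihedralCI.conj (DihedralCI.dih ρ τ₁) π) β = DihedralCI.dih ρ τ₁ := by
  obtain ⟨n, hc⟩ := hsetup.config hG hreg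
  obtain ⟨β, hβ, hw⟩ := hc.exists_twoClosure_conj x
  refine ⟨β, hβ, ?_⟩
  rw [hsetup.conj_dih]
  refine DihedralCI.conj_eq_of_le hsetup.dihedral₂.regular hsetup.dihedral₁.regular x
    fun g hg => ?_
  obtain ⟨a, e, rfl⟩ := hsetup.dihedral₂.relations.exists_word hg
  obtain ⟨b, f, hbf⟩ := hw a e
  -- The words produced use the reflection `ρ 2 ^ n * τ₁`; rewritten in terms of `τ₁` they lie in
  -- the original group.
  rw [hbf, (hsetup.dihedral₁.std hsetup.prime hsetup.odd hsetup.distinct).word_retwist]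
  exact DihedralCI.word_mem_dih _ _
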